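/- **Setting.** A two-player zero-sum Markov game with finite state space $\mathcal S$, finite action spaces $\mathcal A,\mathcal B$ and horizon $H$ is given by transition probabilities $\mathbb P_h(\cdot\mid x,a,b)$ on $\mathcal S$ and mean rewards $r_h(x,a,b)\in[0,1]$, $h\in[H]$. It is *linear* with feature map $\phi:\mathcal S\times\mathcal A\times\mathcal B\to\mathbb R^d$ if $\|\phi\|_2\le 1$ and for every $h$ there are a vector $\mu_h$ of $d$ signed measures on $\mathcal S$ and $\theta_h\in\mathbb R^d$ with $\mathbb P_h(\cdot\mid x,a,b)=\langle\phi(x,a,b),\mu_h(\cdot)\rangle$, $r_h(x,a,b)=\langle\phi(x,a,b),\theta_h\rangle$ and $\max\{\|\mu_h(\mathcal S)\|_2,\|\theta_h\|_2\}\le\sqrt d$. Policies $\pi=\{\pi_h:\mathcal S\to\Delta_{\mathcal A}\}$ and $\nu=\{\nu_h:\mathcal S\to\Delta_{\mathcal B}\}$ have values $V_h^{\pi,\nu}(x)=\mathbb E_{\pi,\nu}[\sum_{t=h}^H r_t(x_t,a_t,b_t)\mid x_h=x]$ (and $V_{H+1}^{\pi,\nu}=0$); $V_1^{*,\nu}=\max_\pi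 V_1^{\pi,\nu}$ and $V_1^{\pi,*}=\min_\nu V_1^{\pi,\nu}$. A pair $(\pi^*,\nu^*)$ is a Nash equilibrium if $\pi^*$ and $\nu^*$ are best responses to each other at all $(x,h)$, and then $V_h^*=V_h^{\pi^*,\nu^*}$. For $V:\mathcal S\to\mathbb R$ put $[\mathbb V_hV](x,a,b)=\max\{1,[\mathbb P_hV^2](x,a,b)-([\mathbb P_hV](x,a,b))^2\}$. Given an initial distribution $\xi$ on $\mathcal S$ and a behavior policy $\beta=\{\beta_h:\mathcal S\to\Delta_{\mathcal A\times\mathcal B}\}$, a dataset $\mathcal D$ of size $K$ collected in the game $M$ consists of $K$ independent trajectories with $x_1^\tau\sim\xi$, $(a_h^\tau,b_h^\tau)\sim\beta_h(\cdot\mid x_h^\tau)$, $x_{h+1}^\tau\sim\mathbb P_h(\cdot\mid x_h^\tau,a_h^\tau,b_h^\tau)$ and independent reward observations $r_h^\tau\sim\mathcal N(r_h(x_h^\tau,a_h^\tau,b_h^\tau),1)$. For a Nash equilibrium $(\pi^*,\nu^*)$ of $M$ and $\lambda>0$ let $$\mathbf Z_h^*=\sum_{\tau=1}^K\frac{\phi(x_h^\tau,a_h^\tau,b_h^\tau)\phi(x_h^\tau,a_h^\tau,b_h^\tau)^\top}{[\mathbb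 V_hV_{h+1}^*](x_h^\tau,a_h^\tau,b_h^\tau)}+\lambda I_d,\qquad \|u\|_{\mathbf Z^{-1}}=\sqrt{u^\top\mathbf Z^{-1}u}.$$ **Theorem (lower bound for Markov games).** There are universal constants $c,C>0$ such that the following holds for every horizon $H\ge1$, dimension $d\ge2$, $\delta\in(0,1)$ and sample size $K\ge C\,d^4\log(2Hd/\delta)$. There exist finite $\mathcal S,\mathcal A,\mathcal B$, a feature map $\phi$ into $\mathbb R^d$, an initial distribution $\xi$, a behavior policy $\beta$ and a nonempty class $\mathcal M$ of Markov games of horizon $H$, all linear with feature map $\phi$, each having a Nash equilibrium and satisfying $\lambda_{\min}(\mathbb E_\beta[\phi(x_h,a_h,b_h)\phi(x_h,a_h,b_h)^\top])>0$ for all $h\in[H]$, such that for every (measurable) map sending a dataset $\mathcal D$ of size $K$ to a policy pair $(\widehat\pi,\widehat\nu)$, every $\lambda>0$, every $M\in\mathcal M$ and every Nash equilibrium $(\pi^*,\nu^*)$ of $M$, with probability at least $1-\delta$ over the dataset $\mathcal D$ collected in $M$, $$\sup_{M'\in\mathcal M}\mathbb E_{M'}\big[V_1^{*,\widehat\nu}(x_1)-V_1^{\widehat\pi,*}(x_1)\big]\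 \ge\ c\sqrt d\,\Big(\max_\nu\sum_{h=1}^H\mathbb E_{\pi^*,\nu}\|\phi(x_h,a_h,b_h)\|_{\mathbf Z_h^{*-1}}+\max_\pi\sum_{h=1}^H\mathbb E_{\pi,\nu^*}\|\phi(x_h,a_h,b_h)\|_{\mathbf Z_h^{*-1}}\Big).$$ Here $\mathbb E_{M'}$ is over a dataset of size $K$ collected in $M'$, from which $(\widehat\pi,\widehat\nu)$ is computed, and an independent $x_1\sim\xi$, with the values taken in $M'$; on the right, $\mathbf Z_h^*$ is computed from $\mathcal D$ and $\mathbb E_{\pi,\nu}$ is over a fresh trajectory of $M$ with $x_1\sim\xi$ and $\mathcal D$ fixed. -/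

import Mathlib

open MeasureTheory ProbabilityTheory
open scoped Matrix

noncomputable section

namespace OfflineMG

/-- A two-player zero-sum Markov game of horizon `H` on finite state and action spaces, with
(mean) rewards in `[0, 1]`. Steps are numbered `0, …, H - 1`. -/
structure MarkovGame (S A B : Type) [Fintype S] (H : ℕ) where
  /-- `P h s a b s'` is the probability of moving to `s'` at step `h`. -/
  P : Fin H → S → A → B → stdSimplex ℝ S
  /-- The mean reward. -/
  r : Fin H → S → A → B → ℝ
  r_mem : ∀ h s a b, r h s a b ∈ Set.Icc (0 : ℝ) 1

/-- A (stochastic, Markov) policy of one player with action space `A`. -/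
abbrev Policy (S A : Type) [Fintype A] (H : ℕ) : Type := Fin H → S → stdSimplex ℝ A

/-- The steps `h, h + 1, …, H - 1`. -/
abbrev Step (H h : ℕ) : Type := {t : Fin H // h ≤ (t : ℕ)}

/-- State-action paths `(x_t, a_t, b_t)` for `t = h, …, H - 1`. -/
def Path (S A B : Type) (H h : ℕ) : Type := Step H h → S × A × B

instance {S A B : Type} [Fintype S] [Fintype A] [Fintype B] {H h : ℕ} :
    Fintype (Path S A B H h) :=
  inferInstanceAs (Fintype (Step H h → S × A × B))

instance {S A B : Type} {H h : ℕ} : MeasurableSpace (Path S A B H h) := ⊤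

/-- The joint action probabilities when the two players act independently. -/
def jointPolicy {S A B : Type} [Fintype A] [Fintype B] {H : ℕ}
    (π : Policy S A H) (ν : Policy S B H) : Fin H → S → A × B → ℝ :=
  fun t s ab => (π t s).1 ab.1 * (ν t s).1 ab.2

/-- A game is linear with feature map `φ`. A vector of `d` signed measures on the finite set `S` is
given by its values `μ s' ∈ ℝ^d` at the points `s'`, and its total mass is `∑ s', μ s'`. -/
def IsLinear {S A B : Type} [Fintype S] {H d : ℕ} (G : MarkovGame S A B H)
    (φ : S → A → B → EuclideanSpace ℝ (Fin d)) : Prop :=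
  (∀ s a b, ‖φ s a b‖ ≤ 1) ∧
  ∀ h, ∃ (μ : S → EuclideanSpace ℝ (Fin d)) (θ : EuclideanSpace ℝ (Fin d)),
    (∀ s a b, (∀ s', (G.P h s a b).1 s' = inner ℝ (φ s a b) (μ s')) ∧
      G.r h s a b = inner ℝ (φ s a b) θ) ∧
    ‖∑ s', μ s'‖ ≤ √(d : ℝ) ∧ ‖θ‖ ≤ √(d : ℝ)

section Game

variable {S A B : Type} [Fintype S] [DecidableEq S] [Fintype A] [Fintype B] {H d : ℕ}

/-- The probability of the path `p` over the steps `h, …, H - 1` when `x_h ∼ ξ`,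
`(a_t, b_t) ∼ σ_t(· | x_t)` and `x_{t+1} ∼ P_t(· | x_t, a_t, b_t)`. -/
def pathProb (G : MarkovGame S A B H) (ξ : S → ℝ) (σ : Fin H → S → A × B → ℝ) (h : ℕ)
    (p : Path S A B H h) : ℝ :=
  (∏ t : Step H h, if (t.1 : ℕ) = h then ξ (p t).1 else 1) *
  (∏ t : Step H h, σ t.1 (p t).1 (p t).2) *
  ∏ t : Step H h, ∏ t' : Step H h,
    if (t'.1 : ℕ) = (t.1 : ℕ) + 1 then (G.P t.1 (p t).1 (p t).2.1 (p t).2.2).1 (p t').1 else 1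

/-- The expectation of `∑_{t ≥ h} f_t(x_t, a_t, b_t)` under the path law above. -/
def expSum (G : MarkovGame S A B H) (ξ : S → ℝ) (σ : Fin H → S → A × B → ℝ) (h : ℕ)
    (f : Fin H → S → A → B → ℝ) : ℝ :=
  ∑ p : Path S A B H h,
    pathProb G ξ σ h p * ∑ t : Step H h, f t.1 (p t).1 (p t).2.1 (p t).2.2

/-- The value function `V_h^{π,ν}(x) = E_{π,ν}[∑_{t ≥ h} r_t | x_h = x]`; it vanishes at `h = H`. -/
def value (G : MarkovGame S A B H) (π : Policy S A H) (ν : Policy S B H) (h : ℕ) (x : S) : ℝ :=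
  expSum G (fun s => if s = x then 1 else 0) (jointPolicy π ν) h G.r

/-- `(π, ν)` is a Nash equilibrium: each is a best response to the other, from every step and
state. -/
def IsNash (G : MarkovGame S A B H) (π : Policy S A H) (ν : Policy S B H) : Prop :=
  (∀ π' : Policy S A H, ∀ (h : Fin H) (x : S), value G π' ν h x ≤ value G π ν h x) ∧
  (∀ ν' : Policy S B H, ∀ (h : Fin H) (x : S), value G π ν h x ≤ value G π ν' h x)

/-- The duality gap `V_1^{*,ν}(x) - V_1^{π,*}(x)` at the initial step. -/
def dualityGap (G : MarkovGame S A B H) (π : Policy S A H) (ν : Policy S B H) (x : S) : ℝ :=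
  (⨆ π' : Policy S A H, value G π' ν 0 x) - ⨅ ν' : Policy S B H, value G π ν' 0 x

/-- The truncated conditional variance `max {1, [P_h V²] - [P_h V]²}`. -/
def truncVar (G : MarkovGame S A B H) (h : Fin H) (V : S → ℝ) (s : S) (a : A) (b : B) : ℝ :=
  max 1 ((∑ s', (G.P h s a b).1 s' * V s' ^ 2) - (∑ s', (G.P h s a b).1 s' * V s') ^ 2)

/-- A trajectory: its states and actions at all steps, and its observed rewards. -/
abbrev Trajectory (S A B : Type) (H : ℕ) : Type := Path S A B H 0 × (Step H 0 → ℝ)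

/-- A dataset of `K` trajectories. -/
abbrev Dataset (S A B : Type) (H K : ℕ) : Type := Fin K → Trajectory S A B H

/-- The law of one trajectory with `x_1 ∼ ξ`, actions from the behavior policy `β`, and, given the
states and actions, independent reward observations `r_h^τ ∼ N(r_h(x_h, a_h, b_h), 1)`. -/
def trajectoryLaw (G : MarkovGame S A B H) (ξ : stdSimplex ℝ S)
    (β : Fin H → S → stdSimplex ℝ (A × B)) : Measure (Trajectory S A B H) :=
  ∑ p : Path S A B H 0,
    ENNReal.ofReal (pathProb G ξ.1 (fun t s => (β t s).1) 0 p) •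
      (Measure.dirac p).prod
        (Measure.pi fun t : Step H 0 => gaussianReal (G.r t.1 (p t).1 (p t).2.1 (p t).2.2) 1)

/-- The law of a dataset of `K` independent trajectories. -/
def datasetLaw (G : MarkovGame S A B H) (ξ : stdSimplex ℝ S)
    (β : Fin H → S → stdSimplex ℝ (A × B)) (K : ℕ) : Measure (Dataset S A B H K) :=
  Measure.pi fun _ : Fin K => trajectoryLaw G ξ β

/-- The covariance matrix `E[φ(x_h, a_h, b_h) φ(x_h, a_h, b_h)ᵀ]` under the behavior policy. -/
def featureCov (G : MarkovGame S A B H) (φ : S → A → B → EuclideanSpace ℝ (Fin d))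
    (ξ : stdSimplex ℝ S) (β : Fin H → S → stdSimplex ℝ (A × B)) (h : Step H 0) :
    Matrix (Fin d) (Fin d) ℝ :=
  ∑ p : Path S A B H 0, pathProb G ξ.1 (fun t s => (β t s).1) 0 p •
    Matrix.vecMulVec (φ (p h).1 (p h).2.1 (p h).2.2).ofLp (φ (p h).1 (p h).2.1 (p h).2.2).ofLp

/-- The expected duality gap `E[V_1^{*,ν̂}(x_1) - V_1^{π̂,*}(x_1)]` of the output of `alg`, over a
dataset collected in `G` and an independent `x_1 ∼ ξ`. -/
def expectedGap (G : MarkovGame S A B H) (ξ : stdSimplex ℝ S)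
    (β : Fin H → S → stdSimplex ℝ (A × B)) {K : ℕ}
    (alg : Dataset S A B H K → Policy S A H × Policy S B H) : ℝ :=
  ∫ D, ∑ x, ξ.1 x * dualityGap G (alg D).1 (alg D).2 x ∂(datasetLaw G ξ β K)

/-- The matrix `Z*_h` of the dataset `D` and the equilibrium `(π, ν)` (so that `V* = V^{π,ν}`). -/
def Zstar (G : MarkovGame S A B H) (φ : S → A → B → EuclideanSpace ℝ (Fin d)) (reg : ℝ)
    (π : Policy S A H) (ν : Policy S B H) {K : ℕ} (D : Dataset S A B H K) (h : Fin H) :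
    Matrix (Fin d) (Fin d) ℝ :=
  (∑ τ : Fin K,
    let z := (D τ).1 ⟨h, Nat.zero_le _⟩
    (truncVar G h (value G π ν (h + 1)) z.1 z.2.1 z.2.2)⁻¹ •
      Matrix.vecMulVec (φ z.1 z.2.1 z.2.2).ofLp (φ z.1 z.2.1 z.2.2).ofLp) +
  reg • (1 : Matrix (Fin d) (Fin d) ℝ)

/-- `‖v‖_{Z⁻¹} = √(vᵀ Z⁻¹ v)`. -/
def invNorm (Z : Matrix (Fin d) (Fin d) ℝ) (v : EuclideanSpace ℝ (Fin d)) : ℝ :=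
  √(v.ofLp ⬝ᵥ (Z⁻¹ *ᵥ v.ofLp))

/-- `max_ν' ∑_h E_{π,ν'} ‖φ‖_{Z*_h⁻¹} + max_π' ∑_h E_{π',ν} ‖φ‖_{Z*_h⁻¹}` for the
equilibrium `(π, ν)`; the expectations are over a fresh path with `x_1 ∼ ξ`, for a fixed `D`. -/
def complexity (G : MarkovGame S A B H) (φ : S → A → B → EuclideanSpace ℝ (Fin d)) (reg : ℝ)
    (ξ : stdSimplex ℝ S) (π : Policy S A H) (ν : Policy S B H) {K : ℕ}
    (D : Dataset S A B H K) : ℝ :=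
  (⨆ ν' : Policy S B H, expSum G ξ.1 (jointPolicy π ν') 0
      fun h s a b => invNorm (Zstar G φ reg π ν D h) (φ s a b)) +
  ⨆ π' : Policy S A H, expSum G ξ.1 (jointPolicy π' ν) 0
      fun h s a b => invNorm (Zstar G φ reg π ν D h) (φ s a b)

end Game

end OfflineMG

end

/-!
Take games with a single state, so that a policy pair only has to be good at each step separately.
The actions are sign vectors `a, b ∈ {±1}^k` with `k = d - 1`, and the mean reward at step `h` is
`1/2 + Δ ⟨θ_h, (a - b)/2⟩` for a hidden sign vector `θ_h`; it is optimal for both players to play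
`θ_h`, and the duality gap of `(π, ν)` is `Δ/2` times the sum over steps and coordinates of
`2 - θ_{h,i} (𝔼_π a_i + 𝔼_ν b_i)`.

The behaviour policy explores uniformly the `2k` pairs `(a, b)` with `(a - b)/2 = ± e_i`. Flipping
one bit `θ_{h,i}` then changes the reward, by `2Δ`, on a fraction `1/k` of the samples only, so the
`χ²`-divergence between the two laws of the dataset is `(1 + (exp (4Δ²) - 1)/k)^K - 1`. For
`Δ = √(k/K)/8` this is at most `1/4`, and averaging over `θ` (Assouad's lemma) shows that some game
has expected duality gap of order `Δ H k`.

On the other hand each explored pair is seen of order `K/k` times with high probability (Chernoff).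
Every `φ(a, b)` is a combination of the explored features with squared coefficients summing to at
most `k`, so Cauchy–Schwarz gives `‖φ(a, b)‖_{Z⁻¹} ≲ √(k/(K/k)) = k/√K`, uniformly in the policies.
Hence the complexity term times `√d` is also of order `H k √(k/K)`, that is `Δ H k`.
-/

namespace OfflineMG

section Densities

variable {X Y : Type*} [MeasurableSpace X] [MeasurableSpace Y]

theorem pi_withDensity {ι : Type*} [Fintype ι] {X : ι → Type*} [∀ i, MeasurableSpace (X i)]
    (P : ∀ i, Measure (X i)) [∀ i, IsProbabilityMeasure (P i)] {f : ∀ i, X i → ENNReal}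
    [∀ i, SigmaFinite ((P i).withDensity (f i))] (hf : ∀ i, Measurable (f i)) :
    (Measure.pi fun i => (P i).withDensity (f i)) =
      (Measure.pi P).withDensity fun x => ∏ i, f i (x i) := by
  refine Measure.pi_eq fun s hs => ?_
  have hfs : ∀ i, Measurable ((s i).indicator (f i)) := fun i => (hf i).indicator (hs i)
  have hind : (Set.univ.pi s).indicator (fun x => ∏ i, f i (x i)) =
      fun x => ∏ i, (s i).indicator (f i) (x i) := by
    ext x
    by_cases hx : x ∈ Set.univ.pi s
    · rw [Set.indicator_of_mem hx]
      exact Finset.prod_congr rfl fun i _ =>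
        (Set.indicator_of_mem (hx i (Set.mem_univ i)) _).symm
    · obtain ⟨i, hi⟩ : ∃ i, x i ∉ s i := by simpa [Set.mem_pi] using hx
      rw [Set.indicator_of_notMem hx,
        Finset.prod_eq_zero (Finset.mem_univ i) (Set.indicator_of_notMem hi _)]
  rw [withDensity_apply _ (MeasurableSet.univ_pi hs),
    ← lintegral_indicator (MeasurableSet.univ_pi hs), hind,
    lintegral_prod_eq_prod_lintegral_of_indepFun Finset.univ
      (fun i (x : ∀ i, X i) => (s i).indicator (f i) (x i))
      (iIndepFun_pi fun i => (hfs i).aemeasurable) fun i => (hfs i).comp (measurable_pi_apply i)]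
  refine Finset.prod_congr rfl fun i _ => ?_
  rw [withDensity_apply _ (hs i), ← lintegral_indicator (hs i),
    (measurePreserving_eval P i).lintegral_comp (hfs i)]

theorem pi_withDensity_ofReal {ι : Type*} [Fintype ι] {X : ι → Type*}
    [∀ i, MeasurableSpace (X i)] (P : ∀ i, Measure (X i)) [∀ i, IsProbabilityMeasure (P i)]
    {f : ∀ i, X i → ℝ} (hf0 : ∀ i x, 0 ≤ f i x) (hf : ∀ i, Measurable (f i)) :
    (Measure.pi fun i => (P i).withDensity fun x => ENNReal.ofReal (f i x)) =
      (Measure.pi P).withDensity fun x => ENNReal.ofReal (∏ i, f i (x i)) := by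
  rw [pi_withDensity P fun i => (hf i).ennreal_ofReal]
  simp only [ENNReal.ofReal_prod_of_nonneg fun i _ => hf0 i _]

theorem withDensity_map (μ : Measure X) {g : X → Y} (hg : Measurable g) {f : Y → ENNReal}
    (hf : Measurable f) :
    (μ.map g).withDensity f = (μ.withDensity (f ∘ g)).map g := by
  ext s hs
  rw [withDensity_apply _ hs, Measure.map_apply hg hs, withDensity_apply _ (hg hs),
    Measure.restrict_map hg hs, lintegral_map hf hg]
  rfl

theorem integral_withDensity_ofReal (P : Measure X) {f : X → ℝ} (hf : Measurable f)
    (hf0 : ∀ x, 0 ≤ f x) (g : X → ℝ) :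
    ∫ x, g x ∂(P.withDensity fun x => ENNReal.ofReal (f x)) = ∫ x, f x * g x ∂P := by
  rw [integral_withDensity_eq_integral_toReal_smul hf.ennreal_ofReal
    (ae_of_all _ fun _ => ENNReal.ofReal_lt_top)]
  simp only [ENNReal.toReal_ofReal (hf0 _), smul_eq_mul]

theorem integral_abs_le_sqrt_integral_sq {P : Measure X} [IsProbabilityMeasure P] {f : X → ℝ}
    (hf : MemLp f 2 P) : ∫ x, |f x| ∂P ≤ √(∫ x, f x ^ 2 ∂P) := by
  have hvar := variance_eq_sub hf.abs
  simp only [Pi.pow_apply, Pi.abs_apply, sq_abs] at hvar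
  exact Real.le_sqrt_of_sq_le (by linarith [variance_nonneg |f| P])

theorem abs_integral_sub_integral_le_chiSq {P Q : Measure X} [IsProbabilityMeasure P]
    [IsProbabilityMeasure Q] {f : X → ℝ} (hf0 : ∀ x, 0 ≤ f x) (hf : Measurable f)
    (hf2 : Integrable (fun x => f x ^ 2) P)
    (hQ : Q = P.withDensity fun x => ENNReal.ofReal (f x))
    {g : X → ℝ} (hg : Measurable g) {M : ℝ} (hM : ∀ x, |g x| ≤ M) :
    |∫ x, g x ∂Q - ∫ x, g x ∂P| ≤ M * √(∫ x, f x ^ 2 ∂P - 1) := by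
  have hfL2 : MemLp f 2 P := (memLp_two_iff_integrable_sq hf.aestronglyMeasurable).2 hf2
  have hfi : Integrable f P := hfL2.integrable one_le_two
  have hint_f : ∫ x, f x ∂P = 1 := by
    calc ∫ x, f x ∂P = ∫ _, (1 : ℝ) ∂Q := by
          rw [hQ, integral_withDensity_ofReal P hf hf0]
          simp only [mul_one]
      _ = 1 := by simp
  have hgP : Integrable g P := .of_bound hg.aestronglyMeasurable M (ae_of_all _ hM)
  have hfg : Integrable (fun x => f x * g x) P :=
    hfi.mul_bdd hg.aestronglyMeasurable (ae_of_all _ hM)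
  have hf1 : MemLp (fun x => f x - 1) 2 P := hfL2.sub (memLp_const 1)
  have hM0 : 0 ≤ M := by
    obtain ⟨x⟩ : Nonempty X := P.nonempty_of_neZero
    exact (abs_nonneg _).trans (hM x)
  have hsq : ∫ x, (f x - 1) ^ 2 ∂P = ∫ x, f x ^ 2 ∂P - 1 := by
    have hvar := variance_eq_sub hfL2
    rw [variance_eq_integral hf.aemeasurable, hint_f] at hvar
    simpa using hvar
  rw [hQ, integral_withDensity_ofReal P hf hf0, ← integral_sub hfg hgP]
  calc |∫ x, (f x * g x - g x) ∂P| ≤ ∫ x, |f x * g x - g x| ∂P := abs_integral_le_integral_abs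
    _ ≤ ∫ x, M * |f x - 1| ∂P := by
      refine integral_mono (hfg.sub hgP).abs
        ((hf1.integrable one_le_two).abs.const_mul M) fun x => ?_
      calc |f x * g x - g x| = |g x| * |f x - 1| := by rw [← abs_mul]; ring_nf
        _ ≤ M * |f x - 1| := by gcongr; exact hM x
    _ = M * ∫ x, |f x - 1| ∂P := integral_const_mul _ _
    _ ≤ M * √(∫ x, f x ^ 2 ∂P - 1) := by
      rw [← hsq]
      gcongr
      exact integral_abs_le_sqrt_integral_sq hf1

end Densities

section Gaussian

/-- The density of the normal law `N(m', 1)` with respect to `N(m, 1)`. -/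
noncomputable def gaussianRatio (m m' x : ℝ) : ℝ :=
  Real.exp ((m' - m) * (x - m) - (m' - m) ^ 2 / 2)

theorem gaussianRatio_nonneg (m m' x : ℝ) : 0 ≤ gaussianRatio m m' x := (Real.exp_pos _).le

@[fun_prop]
theorem measurable_gaussianRatio (m m' : ℝ) : Measurable (gaussianRatio m m') := by
  unfold gaussianRatio
  fun_prop

theorem withDensity_gaussianRatio (m m' : ℝ) :
    (gaussianReal m 1).withDensity (fun x => ENNReal.ofReal (gaussianRatio m m' x)) =
      gaussianReal m' 1 := by
  rw [gaussianReal_of_var_ne_zero _ one_ne_zero, gaussianReal_of_var_ne_zero _ one_ne_zero,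
    ← withDensity_mul _ (measurable_gaussianPDF m 1) (by fun_prop)]
  congr 1
  funext x
  simp only [Pi.mul_apply, gaussianPDF, gaussianPDFReal, gaussianRatio]
  rw [← ENNReal.ofReal_mul (by positivity), mul_assoc _ (Real.exp _), ← Real.exp_add]
  congr 3
  push_cast
  ring

theorem gaussianRatio_sq (m m' x : ℝ) : gaussianRatio m m' x ^ 2 =
    Real.exp (-2 * (m' - m) * m - (m' - m) ^ 2) * Real.exp (2 * (m' - m) * x) := by
  rw [gaussianRatio, ← Real.exp_add, ← Real.exp_nat_mul]
  congr 1
  push_cast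
  ring

theorem integrable_gaussianRatio_sq (m m' : ℝ) :
    Integrable (fun x => gaussianRatio m m' x ^ 2) (gaussianReal m 1) := by
  simp only [gaussianRatio_sq]
  exact (integrable_exp_mul_gaussianReal _).const_mul _

theorem integral_gaussianRatio_sq (m m' : ℝ) :
    ∫ x, gaussianRatio m m' x ^ 2 ∂(gaussianReal m 1) = Real.exp ((m' - m) ^ 2) := by
  have hmgf := congrFun (mgf_id_gaussianReal (μ := m) (v := 1)) (2 * (m' - m))
  simp only [mgf, id] at hmgf
  simp only [gaussianRatio_sq]
  rw [integral_const_mul, hmgf, ← Real.exp_add]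
  congr 1
  push_cast
  ring

end Gaussian

section Chernoff

variable {X : Type*} [MeasurableSpace X] (P : Measure X) [IsProbabilityMeasure P] {E : Set X}

theorem mgf_indicator_one_neg_one_le (hE : MeasurableSet E) :
    mgf (E.indicator 1) P (-1) ≤ Real.exp (-(3 / 5 * P.real E)) := by
  have hexp : ∀ x, Real.exp (-1 * E.indicator 1 x) =
      1 - (1 - Real.exp (-1)) * E.indicator (fun _ => 1) x := fun x => by
    by_cases hx : x ∈ E <;> simp [hx]
  have hexp_neg_one : Real.exp (-1) ≤ 2 / 5 := by
    rw [Real.exp_neg, inv_le_comm₀ (by positivity) (by positivity)]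
    linarith [Real.exp_one_gt_d9]
  calc mgf (E.indicator 1) P (-1) = 1 - (1 - Real.exp (-1)) * P.real E := by
        rw [mgf, integral_congr_ae (ae_of_all _ hexp), integral_sub (integrable_const _)
          (((integrable_const 1).indicator hE).const_mul _), integral_const_mul,
          integral_indicator_const _ hE]
        simp
    _ ≤ -(3 / 5 * P.real E) + 1 := by nlinarith [measureReal_nonneg (μ := P) (s := E)]
    _ ≤ Real.exp (-(3 / 5 * P.real E)) := Real.add_one_le_exp _

theorem measureReal_pi_card_filter_le (n : ℕ) [DecidablePred (· ∈ E)] (hE : MeasurableSet E) :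
    (Measure.pi fun _ : Fin n => P).real
      {D | ((Finset.univ.filter fun τ => D τ ∈ E).card : ℝ) ≤ n * P.real E / 2} ≤
        Real.exp (-(n * P.real E / 10)) := by
  set Q : Measure (Fin n → X) := Measure.pi fun _ => P
  set N : Fin n → (Fin n → X) → ℝ := fun τ D => E.indicator 1 (D τ) with hN
  have hindicator : Measurable (E.indicator (1 : X → ℝ)) := measurable_one.indicator hE
  have hNmeas : ∀ τ, Measurable (N τ) := fun τ => hindicator.comp (measurable_pi_apply τ)
  have hcard : ∀ D : Fin n → X,
      ((Finset.univ.filter fun τ => D τ ∈ E).card : ℝ) = (∑ τ, N τ) D := fun D => by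
    simp [hN, Set.indicator_apply, Finset.sum_apply]
  have hmgf : mgf (∑ τ, N τ) Q (-1) ≤ Real.exp (-(3 / 5 * P.real E)) ^ n := by
    have hindep : iIndepFun N Q := iIndepFun_pi fun _ => hindicator.aemeasurable
    rw [hindep.mgf_sum hNmeas]
    have hN' : ∀ τ, mgf (N τ) Q (-1) = mgf (E.indicator 1) P (-1) := fun τ =>
      integral_comp_eval (μ := fun _ : Fin n => P) (i := τ)
        (hindicator.const_mul (-1)).exp.aestronglyMeasurable
    simp only [hN', Finset.prod_const, Finset.card_univ, Fintype.card_fin]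
    exact pow_le_pow_left₀ mgf_nonneg (mgf_indicator_one_neg_one_le P hE) n
  have hint : Integrable (fun D => Real.exp (-1 * (∑ τ, N τ) D)) Q := by
    refine .of_bound (by fun_prop) 1 (ae_of_all _ fun D => ?_)
    rw [Real.norm_eq_abs, Real.abs_exp, Real.exp_le_one_iff, ← hcard]
    linarith [Nat.cast_nonneg (α := ℝ) (Finset.univ.filter fun τ => D τ ∈ E).card]
  simp only [hcard]
  calc Q.real {D | (∑ τ, N τ) D ≤ n * P.real E / 2}
      ≤ Real.exp (-(-1) * (n * P.real E / 2)) * mgf (∑ τ, N τ) Q (-1) :=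
        measure_le_le_exp_mul_mgf _ (by norm_num) hint
    _ ≤ Real.exp (-(-1) * (n * P.real E / 2)) * Real.exp (-(3 / 5 * P.real E)) ^ n := by gcongr
    _ = Real.exp (-(n * P.real E / 10)) := by
      rw [← Real.exp_nat_mul, ← Real.exp_add]
      congr 1
      ring

end Chernoff

section Trajectories

variable {S A B : Type} [Fintype S] {H : ℕ}

theorem pathProb_congr {G G' : MarkovGame S A B H} (hP : G.P = G'.P) (ξ : S → ℝ)
    (σ : Fin H → S → A × B → ℝ) (h : ℕ) (p : Path S A B H h) :
    pathProb G ξ σ h p = pathProb G' ξ σ h p := by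
  simp only [pathProb, hP]

theorem pathProb_nonneg (G : MarkovGame S A B H) {ξ : S → ℝ} (hξ : ∀ s, 0 ≤ ξ s)
    {σ : Fin H → S → A × B → ℝ} (hσ : ∀ t s ab, 0 ≤ σ t s ab) (h : ℕ) (p : Path S A B H h) :
    0 ≤ pathProb G ξ σ h p := by
  refine mul_nonneg (mul_nonneg ?_ ?_) ?_
  · exact Finset.prod_nonneg fun t _ => by split_ifs <;> simp [hξ]
  · exact Finset.prod_nonneg fun t _ => hσ _ _ _
  · exact Finset.prod_nonneg fun t _ => Finset.prod_nonneg fun t' _ => by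
      split_ifs
      · exact (G.P _ _ _ _).2.1 _
      · exact zero_le_one

/-- The mean reward collected at step `t` along the path `p`. -/
def pathReward (G : MarkovGame S A B H) (p : Path S A B H 0) (t : Step H 0) : ℝ :=
  G.r t.1 (p t).1 (p t).2.1 (p t).2.2

/-- The law of the observed rewards given the path `p`. -/
noncomputable def rewardLaw (G : MarkovGame S A B H) (p : Path S A B H 0) :
    Measure (Step H 0 → ℝ) :=
  Measure.pi fun t => gaussianReal (pathReward G p t) 1

/-- The likelihood ratio of a trajectory in `G'` with respect to `G`, for two games with the same
transitions: only the rewards contribute. -/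
noncomputable def likelihoodRatio (G G' : MarkovGame S A B H) (z : Trajectory S A B H) : ℝ :=
  ∏ t, gaussianRatio (pathReward G z.1 t) (pathReward G' z.1 t) (z.2 t)

theorem likelihoodRatio_nonneg (G G' : MarkovGame S A B H) (z : Trajectory S A B H) :
    0 ≤ likelihoodRatio G G' z :=
  Finset.prod_nonneg fun _ _ => gaussianRatio_nonneg _ _ _

theorem integrable_likelihoodRatio_sq_rewardLaw (G G' : MarkovGame S A B H)
    (p : Path S A B H 0) :
    Integrable (fun r => likelihoodRatio G G' (p, r) ^ 2) (rewardLaw G p) := by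
  simp only [likelihoodRatio, ← Finset.prod_pow]
  exact .fintype_prod_dep (μ := fun t => gaussianReal (pathReward G p t) 1)
    fun _ => integrable_gaussianRatio_sq _ _

theorem integral_likelihoodRatio_sq_rewardLaw (G G' : MarkovGame S A B H) (p : Path S A B H 0) :
    ∫ r, likelihoodRatio G G' (p, r) ^ 2 ∂rewardLaw G p =
      Real.exp (∑ t, (pathReward G' p t - pathReward G p t) ^ 2) := by
  simp only [likelihoodRatio, ← Finset.prod_pow, rewardLaw]
  rw [integral_fintype_prod_eq_prod
    (fun t x => gaussianRatio (pathReward G p t) (pathReward G' p t) x ^ 2), Real.exp_sum]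
  exact Finset.prod_congr rfl fun t _ => integral_gaussianRatio_sq _ _

@[fun_prop]
theorem measurable_likelihoodRatio [Finite A] [Finite B] (G G' : MarkovGame S A B H) :
    Measurable (likelihoodRatio G G') := by
  have : Countable (Path S A B H 0) := inferInstanceAs (Countable (Step H 0 → S × A × B))
  refine measurable_from_prod_countable_right fun p => ?_
  simp only [likelihoodRatio]
  fun_prop

variable [Fintype A] [Fintype B]

variable (G : MarkovGame S A B H) (ξ : stdSimplex ℝ S) (β : Fin H → S → stdSimplex ℝ (A × B))

theorem pathProb_behavior_nonneg (p : Path S A B H 0) :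
    0 ≤ pathProb G ξ.1 (fun t s => (β t s).1) 0 p :=
  pathProb_nonneg G ξ.2.1 (fun t s => (β t s).2.1) 0 p

theorem trajectoryLaw_eq_sum_map : trajectoryLaw G ξ β = ∑ p : Path S A B H 0,
    ENNReal.ofReal (pathProb G ξ.1 (fun t s => (β t s).1) 0 p) •
      (rewardLaw G p).map (Prod.mk p) := by
  simp only [trajectoryLaw, Measure.dirac_prod, rewardLaw, pathReward]

theorem integrable_trajectoryLaw {F : Trajectory S A B H → ℝ} (hF : Measurable F)
    (hFp : ∀ p, Integrable (fun r => F (p, r)) (rewardLaw G p)) :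
    Integrable F (trajectoryLaw G ξ β) := by
  rw [trajectoryLaw_eq_sum_map]
  refine integrable_finsetSum_measure.2 fun p _ => .smul_measure ?_ ENNReal.ofReal_ne_top
  rw [integrable_map_measure hF.aestronglyMeasurable measurable_prodMk_left.aemeasurable]
  exact hFp p

theorem integral_trajectoryLaw {F : Trajectory S A B H → ℝ} (hF : Measurable F)
    (hFp : ∀ p, Integrable (fun r => F (p, r)) (rewardLaw G p)) :
    ∫ z, F z ∂(trajectoryLaw G ξ β) = ∑ p : Path S A B H 0,
      pathProb G ξ.1 (fun t s => (β t s).1) 0 p * ∫ r, F (p, r) ∂rewardLaw G p := by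
  have hint := integrable_trajectoryLaw G ξ β hF hFp
  rw [trajectoryLaw_eq_sum_map] at hint ⊢
  rw [integral_finsetSum_measure (integrable_finsetSum_measure.1 hint)]
  refine Finset.sum_congr rfl fun p _ => ?_
  rw [integral_smul_measure,
    integral_map measurable_prodMk_left.aemeasurable hF.aestronglyMeasurable,
    ENNReal.toReal_ofReal (pathProb_behavior_nonneg G ξ β p), smul_eq_mul]

theorem measureReal_trajectoryLaw_preimage_fst (E : Set (Path S A B H 0)) :
    (trajectoryLaw G ξ β).real (Prod.fst ⁻¹' E) =
      ∑ p : Path S A B H 0, pathProb G ξ.1 (fun t s => (β t s).1) 0 p * E.indicator 1 p := by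
  have hE : MeasurableSet (Prod.fst ⁻¹' E : Set (Trajectory S A B H)) :=
    measurable_fst MeasurableSpace.measurableSet_top
  have hmap : ∀ p, (rewardLaw G p).map (Prod.mk p) (Prod.fst ⁻¹' E) = E.indicator 1 p := fun p => by
    rw [Measure.map_apply measurable_prodMk_left hE]
    by_cases hp : p ∈ E <;> simp [hp, Set.preimage, rewardLaw]
  simp only [Measure.real, trajectoryLaw_eq_sum_map, Measure.finsetSum_apply, Measure.smul_apply,
    hmap, smul_eq_mul]
  rw [ENNReal.toReal_sum fun p _ => by by_cases hp : p ∈ E <;> simp [hp]]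
  refine Finset.sum_congr rfl fun p _ => ?_
  by_cases hp : p ∈ E <;> simp [hp, ENNReal.toReal_ofReal, pathProb_behavior_nonneg]

instance [IsProbabilityMeasure (trajectoryLaw G ξ β)] (K : ℕ) :
    IsProbabilityMeasure (datasetLaw G ξ β K) :=
  inferInstanceAs (IsProbabilityMeasure (Measure.pi fun _ : Fin K => trajectoryLaw G ξ β))

variable {G} {G' : MarkovGame S A B H}

theorem trajectoryLaw_eq_withDensity (hP : G.P = G'.P) :
    trajectoryLaw G' ξ β = (trajectoryLaw G ξ β).withDensity
      fun z => ENNReal.ofReal (likelihoodRatio G G' z) := by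
  have hm : Measurable fun z => ENNReal.ofReal (likelihoodRatio G G' z) :=
    (measurable_likelihoodRatio G G').ennreal_ofReal
  rw [trajectoryLaw_eq_sum_map, trajectoryLaw_eq_sum_map, ← Measure.sum_fintype,
    ← Measure.sum_fintype, withDensity_sum]
  congr 1
  funext p
  rw [withDensity_smul_measure, pathProb_congr hP, withDensity_map _ measurable_prodMk_left hm]
  congr 2
  have hpi := pi_withDensity_ofReal (fun t => gaussianReal (pathReward G p t) 1)
    (fun t => gaussianRatio_nonneg (pathReward G p t) (pathReward G' p t))
    fun _ => measurable_gaussianRatio _ _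
  simp only [withDensity_gaussianRatio] at hpi
  exact hpi

theorem abs_integral_datasetLaw_sub_le (hP : G.P = G'.P)
    [IsProbabilityMeasure (trajectoryLaw G ξ β)]
    [IsProbabilityMeasure (trajectoryLaw G' ξ β)] {K : ℕ} {g : Dataset S A B H K → ℝ}
    (hg : Measurable g) {M : ℝ} (hM : ∀ D, |g D| ≤ M) :
    |∫ D, g D ∂(datasetLaw G' ξ β K) - ∫ D, g D ∂(datasetLaw G ξ β K)| ≤
      M * √((∫ z, likelihoodRatio G G' z ^ 2 ∂(trajectoryLaw G ξ β)) ^ K - 1) := by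
  have hL := measurable_likelihoodRatio G G'
  have hL0 := likelihoodRatio_nonneg G G'
  have hL2 : Integrable (fun z => likelihoodRatio G G' z ^ 2) (trajectoryLaw G ξ β) :=
    integrable_trajectoryLaw G ξ β (hL.pow_const 2)
      (integrable_likelihoodRatio_sq_rewardLaw G G')
  have hdensity : datasetLaw G' ξ β K = (datasetLaw G ξ β K).withDensity
      fun D => ENNReal.ofReal (∏ τ, likelihoodRatio G G' (D τ)) := by
    rw [datasetLaw, trajectoryLaw_eq_withDensity ξ β hP]
    exact pi_withDensity_ofReal _ (fun _ => hL0) fun _ => hL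
  have hsq : Integrable (fun D => (∏ τ, likelihoodRatio G G' (D τ)) ^ 2)
      (datasetLaw G ξ β K) := by
    simp only [← Finset.prod_pow]
    exact .fintype_prod_dep (μ := fun _ => trajectoryLaw G ξ β) fun _ => hL2
  have hpow : ∫ D, (∏ τ, likelihoodRatio G G' (D τ)) ^ 2 ∂(datasetLaw G ξ β K) =
      (∫ z, likelihoodRatio G G' z ^ 2 ∂(trajectoryLaw G ξ β)) ^ K := by
    simp only [← Finset.prod_pow, datasetLaw]
    rw [integral_fintype_prod_eq_pow fun z => likelihoodRatio G G' z ^ 2, Fintype.card_fin]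
  rw [← hpow]
  exact abs_integral_sub_integral_le_chiSq (fun D => Finset.prod_nonneg fun τ _ => hL0 (D τ))
    (by fun_prop) hsq hdensity hg hM

end Trajectories

section OneState

theorem sum_pi_prod_mul_apply {ι X : Type*} [Fintype ι] [DecidableEq ι] [Fintype X]
    (q : ι → X → ℝ) (hq : ∀ t, ∑ x, q t x = 1) (t₀ : ι) (f : X → ℝ) :
    ∑ p : ι → X, (∏ t, q t (p t)) * f (p t₀) = ∑ x, q t₀ x * f x := by
  have hprod : ∀ p : ι → X, (∏ t, q t (p t)) * f (p t₀) =
      ∏ t, q t (p t) * if t = t₀ then f (p t) else 1 := fun p => by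
    rw [Finset.prod_mul_distrib, Finset.prod_ite_eq' Finset.univ t₀, if_pos (Finset.mem_univ _)]
  simp only [hprod]
  rw [← Fintype.prod_sum fun t x => q t x * if t = t₀ then f x else 1,
    Finset.prod_eq_single t₀ (fun t _ ht => by simp [ht, hq]) (by simp)]
  simp

theorem sum_jointPolicy {S A B : Type} [Fintype A] [Fintype B] {H : ℕ} (π : Policy S A H)
    (ν : Policy S B H) (t : Fin H) (s : S) : ∑ ab, jointPolicy π ν t s ab = 1 := by
  simp only [jointPolicy, Fintype.sum_prod_type, ← Finset.mul_sum, (ν t s).2.2, mul_one,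
    (π t s).2.2]

theorem sum_jointPolicy_mul_le {S A B : Type} [Fintype A] [Fintype B] {H : ℕ} (π : Policy S A H)
    (ν : Policy S B H) (t : Fin H) (s : S) {f : A × B → ℝ} {c : ℝ} (hf : ∀ ab, f ab ≤ c) :
    ∑ ab, jointPolicy π ν t s ab * f ab ≤ c :=
  calc ∑ ab, jointPolicy π ν t s ab * f ab ≤ ∑ ab, jointPolicy π ν t s ab * c := by
        refine Finset.sum_le_sum fun ab _ => mul_le_mul_of_nonneg_left (hf ab) ?_
        exact mul_nonneg ((π t s).2.1 _) ((ν t s).2.1 _)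
    _ = c := by rw [← Finset.sum_mul, sum_jointPolicy, one_mul]

theorem card_step_zero (H : ℕ) : Fintype.card (Step H 0) = H := by
  simp [Fintype.card_subtype]

variable {S A B : Type} [Unique S] [Fintype S] {H d : ℕ} (G : MarkovGame S A B H)

theorem simplex_default (ξ : stdSimplex ℝ S) : ξ.1 default = 1 :=
  stdSimplex.eq_one_of_unique ξ default

theorem transition_eq_one (h : Fin H) (s : S) (a : A) (b : B) (s' : S) :
    (G.P h s a b).1 s' = 1 :=
  stdSimplex.eq_one_of_unique (G.P h s a b) s'

theorem truncVar_eq_one (h : Fin H) (V : S → ℝ) (s : S) (a : A) (b : B) :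
    truncVar G h V s a b = 1 := by
  simp [truncVar, transition_eq_one]

theorem pathProb_eq_prod {ξ : S → ℝ} (hξ : ξ default = 1) (σ : Fin H → S → A × B → ℝ) (h : ℕ)
    (p : Path S A B H h) : pathProb G ξ σ h p = ∏ t, σ t.1 (p t).1 (p t).2 := by
  have hξ' : ∀ s, ξ s = 1 := fun s => by rw [Subsingleton.elim s default, hξ]
  simp [pathProb, transition_eq_one, hξ']

variable [Fintype A] [Fintype B]

theorem sum_pathProb_mul_apply {ξ : S → ℝ} (hξ : ξ default = 1) {σ : Fin H → S → A × B → ℝ}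
    (hσ : ∀ t, ∑ ab, σ t default ab = 1) {h : ℕ} (t : Step H h)
    (f : S × A × B → ℝ) :
    ∑ p : Path S A B H h, pathProb G ξ σ h p * f (p t) =
      ∑ ab, σ t.1 default ab * f (default, ab) := by
  simp only [pathProb_eq_prod G hξ]
  have hmarginal := sum_pi_prod_mul_apply (fun (t : Step H h) (x : S × A × B) => σ t.1 x.1 x.2)
    (fun t => by simpa [Fintype.sum_prod_type] using hσ t.1) t f
  refine hmarginal.trans ?_
  simp [Fintype.sum_prod_type]

theorem sum_pathProb {ξ : S → ℝ} (hξ : ξ default = 1) {σ : Fin H → S → A × B → ℝ}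
    (hσ : ∀ t, ∑ ab, σ t default ab = 1) {h : ℕ} :
    ∑ p : Path S A B H h, pathProb G ξ σ h p = 1 := by
  simp only [pathProb_eq_prod G hξ]
  refine (Fintype.prod_sum fun (t : Step H h) (x : S × A × B) => σ t.1 x.1 x.2).symm.trans ?_
  exact Finset.prod_eq_one fun t _ => by simpa [Fintype.sum_prod_type] using hσ t.1

theorem expSum_eq_sum {ξ : S → ℝ} (hξ : ξ default = 1) {σ : Fin H → S → A × B → ℝ}
    (hσ : ∀ t, ∑ ab, σ t default ab = 1) (h : ℕ)
    (f : Fin H → S → A → B → ℝ) :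
    expSum G ξ σ h f =
      ∑ t : Step H h, ∑ ab : A × B, σ t.1 default ab * f t.1 default ab.1 ab.2 := by
  simp only [expSum, Finset.mul_sum]
  rw [Finset.sum_comm]
  exact Finset.sum_congr rfl fun t _ =>
    sum_pathProb_mul_apply G hξ hσ t fun x => f t.1 x.1 x.2.1 x.2.2

theorem expSum_jointPolicy_le (ξ : stdSimplex ℝ S) (π : Policy S A H) (ν : Policy S B H)
    {f : Fin H → S → A → B → ℝ} {c : ℝ} (hf : ∀ h s a b, f h s a b ≤ c) :
    expSum G ξ.1 (jointPolicy π ν) 0 f ≤ H * c := by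
  rw [expSum_eq_sum G (simplex_default ξ) (fun t => sum_jointPolicy π ν t _) 0]
  calc ∑ t : Step H 0, ∑ ab, jointPolicy π ν t.1 default ab * f t.1 default ab.1 ab.2
      ≤ ∑ _t : Step H 0, c :=
        Finset.sum_le_sum fun t _ => sum_jointPolicy_mul_le π ν t.1 default fun _ => hf _ _ _ _
    _ = H * c := by rw [Finset.sum_const, Finset.card_univ, nsmul_eq_mul, card_step_zero]

variable (ξ : stdSimplex ℝ S) (β : Fin H → S → stdSimplex ℝ (A × B))

instance : IsProbabilityMeasure (trajectoryLaw G ξ β) := by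
  rw [isProbabilityMeasure_iff_real]
  have huniv := measureReal_trajectoryLaw_preimage_fst G ξ β Set.univ
  simp only [Set.preimage_univ, Set.indicator_univ, Pi.one_apply, mul_one] at huniv
  rw [huniv, sum_pathProb G (simplex_default ξ) fun t => (β t default).2.2]

theorem featureCov_eq_sum (φ : S → A → B → EuclideanSpace ℝ (Fin d)) (h : Step H 0) :
    featureCov G φ ξ β h = ∑ ab : A × B, (β h.1 default).1 ab •
      Matrix.vecMulVec (φ default ab.1 ab.2).ofLp (φ default ab.1 ab.2).ofLp := by
  ext i j
  simp only [featureCov, Matrix.sum_apply, Matrix.smul_apply, smul_eq_mul]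
  exact sum_pathProb_mul_apply G (simplex_default ξ) (fun t => (β t default).2.2) h
    fun x => Matrix.vecMulVec (φ x.1 x.2.1 x.2.2).ofLp (φ x.1 x.2.1 x.2.2).ofLp i j

end OneState

section Exploration

theorem invNorm_le_of_eq_sum_smul {ι : Type*} [Fintype ι] {d : ℕ} {Z : Matrix (Fin d) (Fin d) ℝ}
    (hZ : IsUnit Z) {ψ : ι → Fin d → ℝ} {n : ℝ} (hn : 0 < n)
    (hdom : ∀ w, n * ∑ j, (ψ j ⬝ᵥ w) ^ 2 ≤ w ⬝ᵥ Z *ᵥ w)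
    {c : ι → ℝ} {v : EuclideanSpace ℝ (Fin d)} (hv : v.ofLp = ∑ j, c j • ψ j) :
    invNorm Z v ≤ √((∑ j, c j ^ 2) / n) := by
  refine Real.sqrt_le_sqrt ?_
  set w := Z⁻¹ *ᵥ v.ofLp with hw
  have hZw : Z *ᵥ w = v.ofLp := by
    rw [hw, Matrix.mulVec_mulVec, Matrix.mul_nonsing_inv _ ((Matrix.isUnit_iff_isUnit_det Z).1 hZ),
      Matrix.one_mulVec]
  have hq : v.ofLp ⬝ᵥ w = ∑ j, c j * (ψ j ⬝ᵥ w) := by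
    simp only [hv, sum_dotProduct, smul_dotProduct, smul_eq_mul]
  have hdom_w : n * ∑ j, (ψ j ⬝ᵥ w) ^ 2 ≤ v.ofLp ⬝ᵥ w := by
    have hw' := hdom w
    rwa [hZw, dotProduct_comm w] at hw'
  have hcauchy : (v.ofLp ⬝ᵥ w) ^ 2 ≤ (∑ j, c j ^ 2) * ∑ j, (ψ j ⬝ᵥ w) ^ 2 := by
    rw [hq]
    exact Finset.sum_mul_sq_le_sq_mul_sq _ _ _
  have hc : 0 ≤ ∑ j, c j ^ 2 := Finset.sum_nonneg fun j _ => sq_nonneg _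
  have hnonneg : 0 ≤ v.ofLp ⬝ᵥ w :=
    (mul_nonneg hn.le (Finset.sum_nonneg fun j _ => sq_nonneg _)).trans hdom_w
  rw [le_div_iff₀ hn]
  rcases hnonneg.eq_or_lt with hzero | hpos
  · rwa [← hzero, zero_mul]
  · refine le_of_mul_le_mul_left ?_ hpos
    nlinarith [mul_le_mul_of_nonneg_left hdom_w hc]

theorem dotProduct_vecMulVec_self_mulVec {m : Type*} [Fintype m] (v w : m → ℝ) :
    w ⬝ᵥ Matrix.vecMulVec v v *ᵥ w = (v ⬝ᵥ w) ^ 2 := by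
  rw [Matrix.vecMulVec_mulVec, dotProduct_smul, dotProduct_comm w, op_smul_eq_mul, sq]

theorem sum_card_filter_eq_mul_le {α β ι : Type*} [Fintype α] [Fintype ι] [DecidableEq β]
    (act : α → β) (e : ι ↪ β) {f : β → ℝ} (hf : ∀ b, 0 ≤ f b) :
    ∑ j, ((Finset.univ.filter fun τ => act τ = e j).card : ℝ) * f (e j) ≤ ∑ τ, f (act τ) := by
  have hfiber : ∀ b, ((Finset.univ.filter fun τ => act τ = b).card : ℝ) * f b =
      ∑ τ with act τ = b, f (act τ) := fun b => by
    rw [← nsmul_eq_mul, ← Finset.sum_const]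
    exact Finset.sum_congr rfl fun τ hτ => by rw [(Finset.mem_filter.1 hτ).2]
  simp only [hfiber]
  rw [← Finset.sum_map Finset.univ e fun b => ∑ τ with act τ = b, f (act τ)]
  exact Finset.sum_fiberwise_le_sum_of_sum_fiber_nonneg fun b _ =>
    Finset.sum_nonneg fun τ _ => hf _

theorem posDef_sum_vecMulVec_self {ι m : Type*} [Fintype ι] [Fintype m] {ψ : ι → m → ℝ}
    (hψ : ∀ w, (∀ j, ψ j ⬝ᵥ w = 0) → w = 0) :
    (∑ j, Matrix.vecMulVec (ψ j) (ψ j)).PosDef := by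
  have hgram : ∑ j, Matrix.vecMulVec (ψ j) (ψ j) = (Matrix.of ψ)ᴴ * Matrix.of ψ := by
    ext a b
    simp [Matrix.sum_apply, Matrix.vecMulVec_apply, Matrix.mul_apply]
  rw [hgram]
  refine Matrix.PosDef.conjTranspose_mul_self _ ?_
  refine (injective_iff_map_eq_zero (Matrix.of ψ).mulVecLin).2 fun w hw => hψ w fun j => ?_
  exact congrFun hw j

section Zstar

variable {S A B : Type} [Unique S] [Fintype S] [Fintype A] [Fintype B] {H K d : ℕ}
  (G : MarkovGame S A B H) {φ : S → A → B → EuclideanSpace ℝ (Fin d)} {reg : ℝ}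
  (π : Policy S A H) (ν : Policy S B H) (D : Dataset S A B H K) (h : Fin H)

/-- The feature vector seen at step `h` of the `τ`-th trajectory of the dataset. -/
def observedFeature (φ : S → A → B → EuclideanSpace ℝ (Fin d)) (D : Dataset S A B H K)
    (h : Fin H) (τ : Fin K) : Fin d → ℝ :=
  (φ default ((D τ).1 ⟨h, Nat.zero_le _⟩).2.1 ((D τ).1 ⟨h, Nat.zero_le _⟩).2.2).ofLp

theorem Zstar_eq_sum :
    Zstar G φ reg π ν D h =
      ∑ τ, Matrix.vecMulVec (observedFeature φ D h τ) (observedFeature φ D h τ) + reg • 1 := by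
  simp only [Zstar, observedFeature, truncVar_eq_one, inv_one, one_smul, Unique.eq_default]

theorem posDef_Zstar (hreg : 0 < reg) : (Zstar G φ reg π ν D h).PosDef := by
  rw [Zstar_eq_sum]
  refine Matrix.PosDef.posSemidef_add (Matrix.posSemidef_sum _ fun τ _ => ?_)
    (Matrix.PosDef.one.smul hreg)
  simpa only [star_trivial] using
    Matrix.posSemidef_vecMulVec_self_star (observedFeature φ D h τ)

theorem sum_sq_le_dotProduct_Zstar_mulVec (hreg : 0 ≤ reg) (w : Fin d → ℝ) :
    ∑ τ, (observedFeature φ D h τ ⬝ᵥ w) ^ 2 ≤ w ⬝ᵥ Zstar G φ reg π ν D h *ᵥ w := by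
  have hreg_term : 0 ≤ reg * (w ⬝ᵥ w) :=
    mul_nonneg hreg (Finset.sum_nonneg fun i _ => mul_self_nonneg (w i))
  simpa only [Zstar_eq_sum, Matrix.add_mulVec, dotProduct_add, Matrix.sum_mulVec, dotProduct_sum,
    Matrix.smul_mulVec, Matrix.one_mulVec, dotProduct_smul, smul_eq_mul,
    dotProduct_vecMulVec_self_mulVec, le_add_iff_nonneg_right] using hreg_term

end Zstar

section UniformDesign

variable {S A B ι : Type} [Fintype S] [Fintype A] [Fintype B] [Fintype ι] [Nonempty ι] {H d : ℕ}

/-- The uniform distribution on the action pairs `e j` of an experimental design. -/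
noncomputable def uniformDesign (e : ι ↪ A × B) : stdSimplex ℝ (A × B) :=
  stdSimplex.map e stdSimplex.barycenter

theorem sum_uniformDesign_smul {E : Type*} [AddCommGroup E] [Module ℝ E] (e : ι ↪ A × B)
    (f : A × B → E) :
    ∑ ab, (uniformDesign e).1 ab • f ab = (Fintype.card ι : ℝ)⁻¹ • ∑ j, f (e j) := by
  classical
  have hval : ∀ ab, (uniformDesign e).1 ab = ∑ j with e j = ab, (Fintype.card ι : ℝ)⁻¹ := fun ab =>
    FunOnFinite.linearMap_apply_apply ℝ ℝ e _ ab
  simp only [hval, Finset.sum_smul]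
  rw [Finset.smul_sum, ← Finset.sum_fiberwise (g := e) (s := Finset.univ)]
  refine Finset.sum_congr rfl fun ab _ => Finset.sum_congr rfl fun j hj => ?_
  rw [(Finset.mem_filter.1 hj).2]

variable [Unique S] (G : MarkovGame S A B H) (ξ : stdSimplex ℝ S) (e : ι ↪ A × B)

theorem posDef_featureCov_uniformDesign {φ : S → A → B → EuclideanSpace ℝ (Fin d)}
    (hφ : ∀ w, (∀ j, (φ default (e j).1 (e j).2).ofLp ⬝ᵥ w = 0) → w = 0) (h : Step H 0) :
    (featureCov G φ ξ (fun _ _ => uniformDesign e) h).PosDef := by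
  rw [featureCov_eq_sum, sum_uniformDesign_smul]
  exact (posDef_sum_vecMulVec_self hφ).smul (by positivity)

theorem measureReal_trajectoryLaw_uniformDesign (h : Step H 0) (j : ι) :
    (trajectoryLaw G ξ fun _ _ => uniformDesign e).real (Prod.fst ⁻¹' {p | (p h).2 = e j}) =
      (Fintype.card ι : ℝ)⁻¹ := by
  rw [measureReal_trajectoryLaw_preimage_fst]
  let f : A × B → ℝ := Set.indicator {e j} 1
  calc _ = ∑ ab, (uniformDesign e).1 ab * f ab :=
        sum_pathProb_mul_apply G (simplex_default ξ) (σ := fun _ _ => (uniformDesign e).1)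
          (fun _ => (uniformDesign e).2.2) h fun x => f x.2
    _ = (Fintype.card ι : ℝ)⁻¹ * ∑ j', f (e j') := sum_uniformDesign_smul e f
    _ = (Fintype.card ι : ℝ)⁻¹ := by
      classical
      simp only [f, Set.indicator_apply, Set.mem_singleton_iff, EmbeddingLike.apply_eq_iff_eq]
      simp

end UniformDesign

section ActionCount

variable {S A B ι : Type} [DecidableEq A] [DecidableEq B] [Fintype ι] {H K d : ℕ}

/-- The number of trajectories of the dataset that play the action pair `ab` at step `h`. -/
def actionCount (D : Dataset S A B H K) (h : Step H 0) (ab : A × B) : ℕ :=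
  (Finset.univ.filter fun τ => ((D τ).1 h).2 = ab).card

theorem mul_sum_sq_le_sum_observedFeature_sq [Unique S] (e : ι ↪ A × B)
    {φ : S → A → B → EuclideanSpace ℝ (Fin d)} (D : Dataset S A B H K) {h : Fin H} {n : ℝ}
    (hD : ∀ j, n ≤ actionCount D ⟨h, Nat.zero_le _⟩ (e j)) (w : Fin d → ℝ) :
    n * ∑ j, ((φ default (e j).1 (e j).2).ofLp ⬝ᵥ w) ^ 2 ≤
      ∑ τ, (observedFeature φ D h τ ⬝ᵥ w) ^ 2 := by
  let f : A × B → ℝ := fun ab => ((φ default ab.1 ab.2).ofLp ⬝ᵥ w) ^ 2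
  calc n * ∑ j, f (e j)
      ≤ ∑ j, (actionCount D ⟨h, Nat.zero_le _⟩ (e j) : ℝ) * f (e j) := by
        rw [Finset.mul_sum]
        exact Finset.sum_le_sum fun j _ => mul_le_mul_of_nonneg_right (hD j) (sq_nonneg _)
    _ ≤ ∑ τ, f ((D τ).1 ⟨h, Nat.zero_le _⟩).2 :=
        sum_card_filter_eq_mul_le (fun τ => ((D τ).1 ⟨h, Nat.zero_le _⟩).2) e fun _ => sq_nonneg _

variable [Fintype S] [Fintype A] [Fintype B]

theorem invNorm_Zstar_le [Unique S] (G : MarkovGame S A B H) (e : ι ↪ A × B)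
    {φ : S → A → B → EuclideanSpace ℝ (Fin d)} {reg : ℝ} (hreg : 0 < reg)
    (π : Policy S A H) (ν : Policy S B H) (D : Dataset S A B H K) {h : Fin H} {n : ℝ} (hn : 0 < n)
    (hD : ∀ j, n ≤ actionCount D ⟨h, Nat.zero_le _⟩ (e j)) {c : ι → ℝ}
    {v : EuclideanSpace ℝ (Fin d)}
    (hv : v.ofLp = ∑ j, c j • (φ default (e j).1 (e j).2).ofLp) :
    invNorm (Zstar G φ reg π ν D h) v ≤ √((∑ j, c j ^ 2) / n) :=
  invNorm_le_of_eq_sum_smul (posDef_Zstar G π ν D h hreg).isUnit hn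
    (fun w => (mul_sum_sq_le_sum_observedFeature_sq e D hD w).trans
      (sum_sq_le_dotProduct_Zstar_mulVec G π ν D h hreg.le w)) hv

theorem complexity_le [Unique S] [Nonempty A] [Nonempty B] (G : MarkovGame S A B H)
    (e : ι ↪ A × B) {φ : S → A → B → EuclideanSpace ℝ (Fin d)} {reg : ℝ} (hreg : 0 < reg)
    (ξ : stdSimplex ℝ S) (π : Policy S A H) (ν : Policy S B H) (D : Dataset S A B H K) {n q : ℝ}
    (hn : 0 < n) (hD : ∀ h j, n ≤ actionCount D h (e j))
    (hφ : ∀ a b, ∃ c : ι → ℝ, (φ default a b).ofLp =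
      ∑ j, c j • (φ default (e j).1 (e j).2).ofLp ∧ ∑ j, c j ^ 2 ≤ q) :
    complexity G φ reg ξ π ν D ≤ 2 * (H * √(q / n)) := by
  have hnorm : ∀ h s a b, invNorm (Zstar G φ reg π ν D h) (φ s a b) ≤ √(q / n) := by
    intro h s a b
    obtain ⟨c, hc, hcq⟩ := hφ a b
    rw [Unique.eq_default s]
    refine (invNorm_Zstar_le G e hreg π ν D hn (fun j => hD _ j) hc).trans ?_
    gcongr
  rw [complexity, two_mul]
  exact add_le_add (ciSup_le fun ν' => expSum_jointPolicy_le G ξ π ν' hnorm)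
    (ciSup_le fun π' => expSum_jointPolicy_le G ξ π' ν hnorm)

variable [Nonempty ι] [Unique S] (G : MarkovGame S A B H) (ξ : stdSimplex ℝ S) (e : ι ↪ A × B)

theorem measureReal_actionCount_le (h : Step H 0) (j : ι) :
    (datasetLaw G ξ (fun _ _ => uniformDesign e) K).real
      {D | (actionCount D h (e j) : ℝ) ≤ K * (Fintype.card ι : ℝ)⁻¹ / 2} ≤
      Real.exp (-(K * (Fintype.card ι : ℝ)⁻¹ / 10)) := by
  classical
  let E : Set (Trajectory S A B H) := Prod.fst ⁻¹' {p | (p h).2 = e j}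
  have hcount : ∀ D : Dataset S A B H K,
      actionCount D h (e j) = (Finset.univ.filter fun τ => D τ ∈ E).card := fun D =>
    congrArg Finset.card (Finset.filter_congr fun τ _ => Iff.rfl)
  have hchernoff := measureReal_pi_card_filter_le
    (trajectoryLaw G ξ fun _ _ => uniformDesign e) (E := E) K
    (measurable_fst MeasurableSpace.measurableSet_top)
  rw [measureReal_trajectoryLaw_uniformDesign] at hchernoff
  simp only [hcount]
  exact hchernoff

theorem one_sub_le_measureReal_actionCount :
    1 - H * Fintype.card ι * Real.exp (-(K * (Fintype.card ι : ℝ)⁻¹ / 10)) ≤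
      (datasetLaw G ξ (fun _ _ => uniformDesign e) K).real
        {D | ∀ h j, K * (Fintype.card ι : ℝ)⁻¹ / 2 ≤ actionCount D h (e j)} := by
  set μ := datasetLaw G ξ (fun _ _ => uniformDesign e) K
  set m : ℝ := K * (Fintype.card ι : ℝ)⁻¹
  have hunion : μ.real {D | ∀ h j, m / 2 ≤ actionCount D h (e j)}ᶜ ≤
      H * Fintype.card ι * Real.exp (-(m / 10)) := by
    have hsub : {D : Dataset S A B H K | ∀ h j, m / 2 ≤ actionCount D h (e j)}ᶜ ⊆
        ⋃ hj : Step H 0 × ι, {D | (actionCount D hj.1 (e hj.2) : ℝ) ≤ m / 2} := fun D hD => by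
      simp only [Set.mem_compl_iff, Set.mem_ofPred_eq, not_forall, not_le] at hD
      obtain ⟨h, j, hlt⟩ := hD
      exact Set.mem_iUnion.2 ⟨(h, j), hlt.le⟩
    calc _ ≤ μ.real (⋃ hj : Step H 0 × ι, {D | (actionCount D hj.1 (e hj.2) : ℝ) ≤ m / 2}) :=
          measureReal_mono hsub
      _ ≤ ∑ hj : Step H 0 × ι, μ.real {D | (actionCount D hj.1 (e hj.2) : ℝ) ≤ m / 2} :=
          measureReal_iUnion_fintype_le _
      _ ≤ ∑ _hj : Step H 0 × ι, Real.exp (-(m / 10)) :=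
          Finset.sum_le_sum fun hj _ => measureReal_actionCount_le G ξ e hj.1 hj.2
      _ = H * Fintype.card ι * Real.exp (-(m / 10)) := by
          rw [Finset.sum_const, Finset.card_univ, Fintype.card_prod, card_step_zero, nsmul_eq_mul,
            Nat.cast_mul]
  have htotal := measureReal_union_le (μ := μ)
    {D | ∀ h j, m / 2 ≤ actionCount D h (e j)} {D | ∀ h j, m / 2 ≤ actionCount D h (e j)}ᶜ
  rw [Set.union_compl_self, probReal_univ] at htotal
  linarith

theorem mul_exp_neg_le_of_log_div_le {m δ x : ℝ} (hm : 0 ≤ m) (hδ : 0 < δ)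
    (hx : Real.log (m / δ) ≤ x) : m * Real.exp (-x) ≤ δ := by
  rcases hm.eq_or_lt with rfl | hm
  · rw [zero_mul]
    exact hδ.le
  calc m * Real.exp (-x) ≤ m * Real.exp (-Real.log (m / δ)) := by gcongr
    _ = δ := by
      rw [Real.exp_neg, Real.exp_log (by positivity)]
      field_simp

theorem one_sub_le_measureReal_actionCount_of_log_le {m δ : ℝ}
    (hm : Fintype.card ι ≤ m) (hδ : 0 < δ) (hK : 10 * m * Real.log (H * m / δ) ≤ K) :
    1 - δ ≤ (datasetLaw G ξ (fun _ _ => uniformDesign e) K).real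
      {D | ∀ h j, K * (Fintype.card ι : ℝ)⁻¹ / 2 ≤ actionCount D h (e j)} := by
  have hcard : (0 : ℝ) < Fintype.card ι := Nat.cast_pos.2 Fintype.card_pos
  have hm_pos : 0 < m := hcard.trans_le hm
  have hlog : Real.log (H * m / δ) ≤ K * (Fintype.card ι : ℝ)⁻¹ / 10 :=
    calc Real.log (H * m / δ) ≤ K * m⁻¹ / 10 := by
          rw [← div_eq_mul_inv, div_div, le_div_iff₀ (by positivity)]
          linarith
      _ ≤ K * (Fintype.card ι : ℝ)⁻¹ / 10 := by gcongr
  have hδ_le : H * Fintype.card ι * Real.exp (-(K * (Fintype.card ι : ℝ)⁻¹ / 10)) ≤ δ :=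
    (by gcongr : _ ≤ H * m * Real.exp (-(K * (Fintype.card ι : ℝ)⁻¹ / 10))).trans
      (mul_exp_neg_le_of_log_div_le (by positivity) hδ hlog)
  exact (sub_le_sub_left hδ_le 1).trans (one_sub_le_measureReal_actionCount G ξ e)

end ActionCount

end Exploration

section SignVectors

/-- A vector in `{±1}^k`, with `true` standing for `1` and `false` for `-1`. -/
abbrev SignVector (k : ℕ) : Type := Fin k → Bool

/-- The sign `1` or `-1` encoded by a Boolean. -/
def boolSign (b : Bool) : ℝ := if b then 1 else -1

@[simp] theorem boolSign_true : boolSign true = 1 := rfl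

@[simp] theorem boolSign_false : boolSign false = -1 := rfl

@[simp] theorem boolSign_not (b : Bool) : boolSign (!b) = -boolSign b := by cases b <;> simp

@[simp] theorem boolSign_mul_self (b : Bool) : boolSign b * boolSign b = 1 := by cases b <;> simp

@[simp] theorem abs_boolSign (b : Bool) : |boolSign b| = 1 := by cases b <;> simp

variable {k : ℕ}

/-- The real vector in `{±1}^k` encoded by a sign vector. -/
def signVec (a : SignVector k) : Fin k → ℝ := fun i => boolSign (a i)

/-- Half the difference `(a - b) / 2` of two sign vectors, with entries in `{-1, 0, 1}`. -/
noncomputable def halfDiff (a b : SignVector k) : Fin k → ℝ :=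
  (1 / 2 : ℝ) • (signVec a - signVec b)

theorem signVec_dotProduct_self (a : SignVector k) : signVec a ⬝ᵥ signVec a = k := by
  simp [dotProduct, signVec]

theorem signVec_dotProduct_le (a : SignVector k) {v : Fin k → ℝ} (hv : ∀ i, |v i| ≤ 1) :
    signVec a ⬝ᵥ v ≤ k := by
  calc signVec a ⬝ᵥ v ≤ ∑ _i : Fin k, (1 : ℝ) := Finset.sum_le_sum fun i _ => by
        refine (le_abs_self _).trans ?_
        rw [abs_mul, signVec, abs_boolSign, one_mul]
        exact hv i
    _ = k := by simp

theorem abs_halfDiff_le (a b : SignVector k) (i : Fin k) : |halfDiff a b i| ≤ 1 := by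
  cases ha : a i <;> cases hb : b i <;> norm_num [halfDiff, signVec, ha, hb]

theorem halfDiff_sq_le (a b : SignVector k) (i : Fin k) : halfDiff a b i ^ 2 ≤ 1 :=
  (sq_le_one_iff_abs_le_one _).2 (abs_halfDiff_le a b i)

theorem halfDiff_comm (a b : SignVector k) : halfDiff b a = -halfDiff a b := by
  rw [halfDiff, halfDiff, ← smul_neg, neg_sub]

theorem abs_signVec_dotProduct_halfDiff_le (θ a b : SignVector k) :
    |signVec θ ⬝ᵥ halfDiff a b| ≤ k := by
  refine abs_le'.2 ⟨signVec_dotProduct_le θ (abs_halfDiff_le a b), ?_⟩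
  rw [← dotProduct_neg, ← halfDiff_comm]
  exact signVec_dotProduct_le θ (abs_halfDiff_le b a)

/-- The mean in `[-1, 1]^k` of a random sign vector. -/
noncomputable def meanSign (q : stdSimplex ℝ (SignVector k)) : Fin k → ℝ :=
  ∑ a, q.1 a • signVec a

theorem abs_meanSign_le (q : stdSimplex ℝ (SignVector k)) (i : Fin k) : |meanSign q i| ≤ 1 :=
  calc |meanSign q i| ≤ ∑ a, |q.1 a * signVec a i| := by
        rw [meanSign, Finset.sum_apply]
        exact Finset.abs_sum_le_sum_abs _ _
    _ = ∑ a, q.1 a := Finset.sum_congr rfl fun a _ => by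
        rw [abs_mul, signVec, abs_boolSign, mul_one, abs_of_nonneg (q.2.1 a)]
    _ = 1 := q.2.2

theorem measurable_meanSign_apply (i : Fin k) :
    Measurable fun q : stdSimplex ℝ (SignVector k) => meanSign q i := by
  simp only [meanSign, Finset.sum_apply, Pi.smul_apply, smul_eq_mul]
  exact Finset.measurable_sum _ fun a _ =>
    ((measurable_pi_apply a).comp measurable_subtype_coe).mul_const _

end SignVectors

section SignGame

variable {k H : ℕ} {Δ : ℝ} (hΔ : 0 ≤ Δ) (hΔk : Δ * k ≤ 1 / 2)

/-- The one-state game in which, at each step `h`, the players choose sign vectors `a` and `b` and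
the mean reward is `1 / 2 + Δ ⟨θ_h, (a - b) / 2⟩` for a hidden sign vector `θ_h`. -/
noncomputable def signGame (θ : Fin H → SignVector k) :
    MarkovGame Unit (SignVector k) (SignVector k) H where
  P _ _ _ _ := stdSimplex.barycenter
  r h _ a b := 1 / 2 + Δ * (signVec (θ h) ⬝ᵥ halfDiff a b)
  r_mem h _ a b := by
    obtain ⟨hlow, hupp⟩ := abs_le.1 (abs_signVec_dotProduct_halfDiff_le (θ h) a b)
    constructor <;> nlinarith

/-- The policy that plays the sign vectors `θ`. -/
noncomputable def purePolicy (θ : Fin H → SignVector k) : Policy Unit (SignVector k) H :=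
  fun h _ => ⟨Pi.single (θ h) 1, single_mem_stdSimplex ℝ (θ h)⟩

theorem meanSign_purePolicy (θ : Fin H → SignVector k) (h : Fin H) (s : Unit) :
    meanSign (purePolicy θ h s) = signVec (θ h) := by
  simp [meanSign, purePolicy, Pi.single_apply]

theorem sum_jointPolicy_smul_halfDiff {S : Type} (π ν : Policy S (SignVector k) H) (t : Fin H)
    (s : S) : ∑ ab, jointPolicy π ν t s ab • halfDiff ab.1 ab.2 =
      (1 / 2 : ℝ) • (meanSign (π t s) - meanSign (ν t s)) := by
  have hπ : ∑ a, (π t s).1 a = 1 := (π t s).2.2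
  have hν : ∑ b, (ν t s).1 b = 1 := (ν t s).2.2
  have hsplit : ∀ a b, jointPolicy π ν t s (a, b) • halfDiff a b = (1 / 2 : ℝ) •
      ((ν t s).1 b • (π t s).1 a • signVec a - (π t s).1 a • (ν t s).1 b • signVec b) :=
    fun a b => by
      simp only [jointPolicy, halfDiff]
      module
  simp only [Fintype.sum_prod_type, hsplit, ← Finset.smul_sum, Finset.sum_sub_distrib,
    ← Finset.sum_smul, hπ, hν, one_smul, meanSign]

theorem value_signGame (θ : Fin H → SignVector k) (π ν : Policy Unit (SignVector k) H) (h : ℕ)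
    (x : Unit) : value (signGame hΔ hΔk θ) π ν h x = ∑ t : Step H h, (1 / 2 + Δ / 2 *
      (signVec (θ t.1) ⬝ᵥ meanSign (π t.1 x) - signVec (θ t.1) ⬝ᵥ meanSign (ν t.1 x))) := by
  have hpoint : (fun s : Unit => if s = x then (1 : ℝ) else 0) default = 1 := if_pos rfl
  rw [value, expSum_eq_sum _ hpoint fun t => sum_jointPolicy π ν t ()]
  refine Finset.sum_congr rfl fun t _ => ?_
  calc ∑ ab, jointPolicy π ν t.1 () ab * (signGame hΔ hΔk θ).r t.1 () ab.1 ab.2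
      = (∑ ab, jointPolicy π ν t.1 () ab) * (1 / 2) +
          Δ * (signVec (θ t.1) ⬝ᵥ ∑ ab, jointPolicy π ν t.1 () ab • halfDiff ab.1 ab.2) := by
        simp only [signGame, dotProduct_sum, dotProduct_smul, smul_eq_mul, Finset.mul_sum,
          Finset.sum_mul, ← Finset.sum_add_distrib]
        exact Finset.sum_congr rfl fun ab _ => by ring
    _ = _ := by
        rw [sum_jointPolicy, sum_jointPolicy_smul_halfDiff, dotProduct_smul, dotProduct_sub,
          smul_eq_mul]
        ring

theorem value_signGame_le_purePolicy (θ : Fin H → SignVector k)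
    (π ν : Policy Unit (SignVector k) H) (h : ℕ) (x : Unit) :
    value (signGame hΔ hΔk θ) π ν h x ≤ value (signGame hΔ hΔk θ) (purePolicy θ) ν h x := by
  simp only [value_signGame, meanSign_purePolicy, signVec_dotProduct_self]
  gcongr
  exact signVec_dotProduct_le _ (abs_meanSign_le _)

theorem value_signGame_purePolicy_le (θ : Fin H → SignVector k)
    (π ν : Policy Unit (SignVector k) H) (h : ℕ) (x : Unit) :
    value (signGame hΔ hΔk θ) π (purePolicy θ) h x ≤ value (signGame hΔ hΔk θ) π ν h x := by
  simp only [value_signGame, meanSign_purePolicy, signVec_dotProduct_self]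
  gcongr
  exact signVec_dotProduct_le _ (abs_meanSign_le _)

theorem isNash_signGame (θ : Fin H → SignVector k) :
    IsNash (signGame hΔ hΔk θ) (purePolicy θ) (purePolicy θ) :=
  ⟨fun π h x => value_signGame_le_purePolicy hΔ hΔk θ π _ h x,
    fun ν h x => value_signGame_purePolicy_le hΔ hΔk θ _ ν h x⟩

theorem dualityGap_signGame (θ : Fin H → SignVector k) (π ν : Policy Unit (SignVector k) H)
    (x : Unit) : dualityGap (signGame hΔ hΔk θ) π ν x = ∑ t : Step H 0, Δ / 2 *
      (2 * k - signVec (θ t.1) ⬝ᵥ (meanSign (π t.1 x) + meanSign (ν t.1 x))) := by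
  have hsup : ⨆ π', value (signGame hΔ hΔk θ) π' ν 0 x =
      value (signGame hΔ hΔk θ) (purePolicy θ) ν 0 x :=
    IsGreatest.csSup_eq ⟨⟨_, rfl⟩, Set.forall_mem_range.2 fun π' =>
      value_signGame_le_purePolicy hΔ hΔk θ π' ν 0 x⟩
  have hinf : ⨅ ν', value (signGame hΔ hΔk θ) π ν' 0 x =
      value (signGame hΔ hΔk θ) π (purePolicy θ) 0 x :=
    IsLeast.csInf_eq ⟨⟨_, rfl⟩, Set.forall_mem_range.2 fun ν' =>
      value_signGame_purePolicy_le hΔ hΔk θ π ν' 0 x⟩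
  rw [dualityGap, hsup, hinf, value_signGame, value_signGame, ← Finset.sum_sub_distrib]
  refine Finset.sum_congr rfl fun t _ => ?_
  rw [meanSign_purePolicy, signVec_dotProduct_self, dotProduct_add]
  ring

end SignGame

section SignFeatures

variable {k H : ℕ}

/-- The feature map `φ(a, b) = (1, (a - b) / (2 √k)) / √2` of the games `signGame`. -/
noncomputable def signFeature (k : ℕ) (_ : Unit) (a b : SignVector k) :
    EuclideanSpace ℝ (Fin (k + 1)) :=
  WithLp.toLp 2 (Matrix.vecCons (√2)⁻¹ ((√(2 * k))⁻¹ • halfDiff a b))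

theorem norm_toLp_vecCons_le_sqrt {x c : ℝ} {v : Fin k → ℝ} (h : x ^ 2 + v ⬝ᵥ v ≤ c) :
    ‖(WithLp.toLp 2 (Matrix.vecCons x v) : EuclideanSpace ℝ (Fin (k + 1)))‖ ≤ √c := by
  rw [EuclideanSpace.norm_eq]
  refine Real.sqrt_le_sqrt ?_
  simpa [Fin.sum_univ_succ, dotProduct, ← sq] using h

theorem inner_toLp_vecCons (x y : ℝ) (v w : Fin k → ℝ) :
    inner ℝ (WithLp.toLp 2 (Matrix.vecCons x v) : EuclideanSpace ℝ (Fin (k + 1)))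
      (WithLp.toLp 2 (Matrix.vecCons y w)) = y * x + w ⬝ᵥ v := by
  rw [EuclideanSpace.inner_toLp_toLp, star_trivial, Matrix.cons_dotProduct_cons]

theorem halfDiff_dotProduct_self_le (a b : SignVector k) : halfDiff a b ⬝ᵥ halfDiff a b ≤ k := by
  calc halfDiff a b ⬝ᵥ halfDiff a b ≤ ∑ _i : Fin k, (1 : ℝ) :=
        Finset.sum_le_sum fun i _ => by rw [← sq]; exact halfDiff_sq_le a b i
    _ = k := by simp

variable [NeZero k]

theorem norm_signFeature_le (s : Unit) (a b : SignVector k) : ‖signFeature k s a b‖ ≤ 1 := by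
  have hk : (0 : ℝ) < k := Nat.cast_pos.2 (NeZero.pos k)
  rw [← Real.sqrt_one]
  refine norm_toLp_vecCons_le_sqrt ?_
  rw [smul_dotProduct, dotProduct_smul, smul_smul, smul_eq_mul, ← mul_inv,
    Real.mul_self_sqrt (by positivity), inv_pow, Real.sq_sqrt zero_le_two]
  calc (2 : ℝ)⁻¹ + (2 * k : ℝ)⁻¹ * (halfDiff a b ⬝ᵥ halfDiff a b) ≤ 2⁻¹ + (2 * k : ℝ)⁻¹ * k := by
        gcongr
        exact halfDiff_dotProduct_self_le a b
    _ = 1 := by field_simp; norm_num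

theorem isLinear_signGame {Δ : ℝ} (hΔ : 0 ≤ Δ) (hΔk : Δ * k ≤ 1 / 2) (θ : Fin H → SignVector k) :
    IsLinear (signGame hΔ hΔk θ) (signFeature k) := by
  have hk : (1 : ℝ) ≤ k := Nat.one_le_cast.2 NeZero.one_le
  have hsqrt : √(2 * k : ℝ) ≠ 0 := by positivity
  refine ⟨norm_signFeature_le, fun h => ⟨fun _ => WithLp.toLp 2 (Matrix.vecCons (√2) 0),
    WithLp.toLp 2 (Matrix.vecCons (√2 / 2) ((Δ * √(2 * k)) • signVec (θ h))),
    fun s a b => ⟨fun s' => ?_, ?_⟩, ?_, ?_⟩⟩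
  · rw [transition_eq_one, signFeature, inner_toLp_vecCons, zero_dotProduct, add_zero,
      mul_inv_cancel₀ (by positivity)]
  · rw [signFeature, inner_toLp_vecCons, smul_dotProduct, dotProduct_smul, smul_smul,
      mul_assoc, mul_inv_cancel₀ hsqrt, smul_eq_mul, mul_one, div_mul_eq_mul_div,
      mul_inv_cancel₀ (by positivity)]
    rfl
  · rw [Fintype.sum_unique]
    refine norm_toLp_vecCons_le_sqrt ?_
    rw [Real.sq_sqrt zero_le_two, zero_dotProduct]
    push_cast
    linarith
  · refine norm_toLp_vecCons_le_sqrt ?_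
    rw [smul_dotProduct, dotProduct_smul, signVec_dotProduct_self, smul_eq_mul, smul_eq_mul,
      div_pow, Real.sq_sqrt zero_le_two]
    have hsq : Δ * √(2 * k) * (Δ * √(2 * k) * k) = 2 * (Δ * k) ^ 2 := by
      linear_combination Δ ^ 2 * k * Real.mul_self_sqrt (show (0 : ℝ) ≤ 2 * k by positivity)
    push_cast
    nlinarith [mul_nonneg hΔ (zero_le_one.trans hk)]

end SignFeatures

section SignDesign

variable {k : ℕ}

/-- The `2k` action pairs `(a, b)` with `(a - b) / 2 = ± e_i`. -/
def signDesign (k : ℕ) : Fin k × Bool ↪ SignVector k × SignVector k where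
  toFun j := (Function.update (fun _ => true) j.1 j.2, Function.update (fun _ => true) j.1 (!j.2))
  inj' := by
    rintro ⟨i, s⟩ ⟨i', s'⟩ h
    obtain rfl : i = i' := by
      by_contra hne
      have hfst := congrFun (Prod.ext_iff.1 h).1 i
      have hsnd := congrFun (Prod.ext_iff.1 h).2 i
      simp only [Function.update_self, Function.update_of_ne hne] at hfst hsnd
      rw [hfst] at hsnd
      exact Bool.false_ne_true hsnd
    have hfst := congrFun (Prod.ext_iff.1 h).1 i
    simpa using hfst

theorem signDesign_apply (j : Fin k × Bool) : signDesign k j =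
    (Function.update (fun _ => true) j.1 j.2, Function.update (fun _ => true) j.1 (!j.2)) := rfl

theorem halfDiff_signDesign (j : Fin k × Bool) :
    halfDiff (signDesign k j).1 (signDesign k j).2 = Pi.single j.1 (boolSign j.2) := by
  funext i
  by_cases h : i = j.1
  · subst h
    simp only [halfDiff, signVec, signDesign_apply, Pi.smul_apply, Pi.sub_apply,
      Function.update_self, boolSign_not, smul_eq_mul, Pi.single_eq_same]
    ring
  · simp [halfDiff, signVec, signDesign_apply, h]

/-- The coefficients of `φ(a, b)` in the features of the action pairs `signDesign`. -/
noncomputable def signDesignCoeff (a b : SignVector k) (j : Fin k × Bool) : ℝ :=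
  ((k : ℝ)⁻¹ + boolSign j.2 * halfDiff a b j.1) / 2

theorem sum_signDesignCoeff_sq_le [NeZero k] (a b : SignVector k) :
    ∑ j, signDesignCoeff a b j ^ 2 ≤ k := by
  have hinv : (k : ℝ)⁻¹ ≤ 1 := inv_le_one_of_one_le₀ (Nat.one_le_cast.2 NeZero.one_le)
  have hinv_nonneg : 0 ≤ (k : ℝ)⁻¹ := by positivity
  calc ∑ j, signDesignCoeff a b j ^ 2
      = ∑ i, (((k : ℝ)⁻¹) ^ 2 + halfDiff a b i ^ 2) / 2 := by
        rw [Fintype.sum_prod_type]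
        refine Finset.sum_congr rfl fun i _ => ?_
        simp only [Fintype.sum_bool, signDesignCoeff, boolSign_true, boolSign_false]
        ring
    _ ≤ ∑ _i : Fin k, (1 : ℝ) := Finset.sum_le_sum fun i _ => by
        nlinarith [halfDiff_sq_le a b i]
    _ = k := by simp

theorem sum_signDesignCoeff_smul [NeZero k] (a b : SignVector k) :
    ∑ j, signDesignCoeff a b j • (signFeature k () (signDesign k j).1 (signDesign k j).2).ofLp =
      (signFeature k () a b).ofLp := by
  simp only [signFeature, halfDiff_signDesign, Fintype.sum_prod_type, Fintype.sum_bool]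
  refine funext (Fin.cases ?_ fun i => ?_)
  · have hmass : ∀ i : Fin k, signDesignCoeff a b (i, true) + signDesignCoeff a b (i, false) =
        (k : ℝ)⁻¹ := fun i => by
      simp only [signDesignCoeff, boolSign_true, boolSign_false]
      ring
    simp only [Finset.sum_apply, Pi.add_apply, Pi.smul_apply, Matrix.cons_val_zero, smul_eq_mul,
      ← add_mul, hmass, Finset.sum_const, Finset.card_univ, Fintype.card_fin, nsmul_eq_mul]
    rw [← mul_assoc, mul_inv_cancel₀ (NeZero.ne _), one_mul]
  · have hcoeff : ∀ l : Fin k, signDesignCoeff a b (l, true) - signDesignCoeff a b (l, false) =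
        halfDiff a b l := fun l => by
      simp only [signDesignCoeff, boolSign_true, boolSign_false]
      ring
    calc _ = ∑ l : Fin k, (signDesignCoeff a b (l, true) - signDesignCoeff a b (l, false)) *
          ((√(2 * k))⁻¹ * (Pi.single l 1 : Fin k → ℝ) i) := by
          simp only [Finset.sum_apply, Pi.add_apply, Pi.smul_apply, Matrix.cons_val_succ,
            smul_eq_mul, boolSign_true, boolSign_false, Pi.single_neg, Pi.neg_apply]
          exact Finset.sum_congr rfl fun l _ => by ring
      _ = (√(2 * k))⁻¹ * halfDiff a b i := by
          simp [hcoeff, Pi.single_apply, mul_comm]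
      _ = _ := rfl

theorem eq_zero_of_signFeature_signDesign_dotProduct_eq_zero [NeZero k] {w : Fin (k + 1) → ℝ}
    (hw : ∀ j, (signFeature k () (signDesign k j).1 (signDesign k j).2).ofLp ⬝ᵥ w = 0) :
    w = 0 := by
  have hk : (0 : ℝ) < k := Nat.cast_pos.2 (NeZero.pos k)
  have hsum : ∀ (i : Fin k) (s : Bool),
      (√2)⁻¹ * w 0 + (√(2 * k))⁻¹ * (boolSign s * w i.succ) = 0 := fun i s => by
    have h := hw (i, s)
    rwa [signFeature, halfDiff_signDesign, Matrix.cons_dotProduct, smul_dotProduct,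
      single_dotProduct, smul_eq_mul] at h
  refine funext (Fin.cases ?_ fun i => ?_)
  · have hzero : (√2)⁻¹ * w 0 = 0 := by
      have htrue := hsum 0 true
      have hfalse := hsum 0 false
      rw [boolSign_true] at htrue
      rw [boolSign_false] at hfalse
      linarith
    exact (mul_eq_zero.1 hzero).resolve_left (by positivity)
  · have hsucc : (√(2 * k))⁻¹ * w i.succ = 0 := by
      have htrue := hsum i true
      have hfalse := hsum i false
      rw [boolSign_true] at htrue
      rw [boolSign_false] at hfalse
      linarith
    exact (mul_eq_zero.1 hsucc).resolve_left (by positivity)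

end SignDesign

section Averaging

theorem sum_mul_le_of_involutive {Θ : Type*} [Fintype Θ] {σ : Θ → Θ}
    (hσ : Function.Involutive σ) {s F : Θ → ℝ} {ε : ℝ} (hs : ∀ θ, |s θ| ≤ 1)
    (hsσ : ∀ θ, s (σ θ) = -s θ) (hF : ∀ θ, |F (σ θ) - F θ| ≤ ε) :
    ∑ θ, s θ * F θ ≤ Fintype.card Θ * (ε / 2) := by
  have hflip : ∑ θ, s θ * F θ = ∑ θ, -s θ * F (σ θ) := by
    rw [← Equiv.sum_comp hσ.toPerm]
    simp only [Function.Involutive.coe_toPerm, hsσ]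
  have hpair : ∑ θ, (s θ * F θ + -s θ * F (σ θ)) ≤ Fintype.card Θ * ε := by
    rw [← nsmul_eq_mul, ← Finset.card_univ]
    refine Finset.sum_le_card_nsmul _ _ _ fun θ _ => ?_
    calc s θ * F θ + -s θ * F (σ θ) = -(s θ * (F (σ θ) - F θ)) := by ring
      _ ≤ |s θ| * |F (σ θ) - F θ| := by rw [← abs_mul]; exact neg_le_abs _
      _ ≤ 1 * ε := mul_le_mul (hs θ) (hF θ) (abs_nonneg _) zero_le_one
      _ = ε := one_mul ε
  rw [Finset.sum_add_distrib, ← hflip] at hpair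
  linarith

end Averaging

section FlipSign

variable {k H : ℕ}

/-- The hidden sign vectors obtained from `θ` by flipping the `i`-th sign at step `h`. -/
def flipSign (h : Fin H) (i : Fin k) (θ : Fin H → SignVector k) : Fin H → SignVector k :=
  Function.update θ h (Function.update (θ h) i (!θ h i))

theorem flipSign_self_apply (h : Fin H) (i : Fin k) (θ : Fin H → SignVector k) :
    flipSign h i θ h i = !θ h i := by
  rw [flipSign, Function.update_self, Function.update_self]

theorem flipSign_involutive (h : Fin H) (i : Fin k) : Function.Involutive (flipSign h i) :=
  fun θ => by simp [flipSign]

theorem signVec_update_not (a : SignVector k) (i : Fin k) :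
    signVec (Function.update a i (!a i)) = signVec a - Pi.single i (2 * boolSign (a i)) := by
  funext l
  by_cases hl : l = i
  · subst hl
    simp only [signVec, Function.update_self, boolSign_not, Pi.sub_apply, Pi.single_eq_same]
    ring
  · simp [signVec, hl]

variable {Δ : ℝ} (hΔ : 0 ≤ Δ) (hΔk : Δ * k ≤ 1 / 2)

theorem pathReward_signGame_flipSign_sub_sq (h : Fin H) (i : Fin k) (θ : Fin H → SignVector k)
    (p : Path Unit (SignVector k) (SignVector k) H 0) (t : Step H 0) :
    (pathReward (signGame hΔ hΔk (flipSign h i θ)) p t -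
      pathReward (signGame hΔ hΔk θ) p t) ^ 2 =
      if t = ⟨h, Nat.zero_le _⟩ then 4 * Δ ^ 2 * halfDiff (p t).2.1 (p t).2.2 i ^ 2 else 0 := by
  simp only [pathReward, signGame]
  rw [add_sub_add_left_eq_sub, ← mul_sub, ← sub_dotProduct]
  split_ifs with ht
  · subst ht
    rw [flipSign, Function.update_self, signVec_update_not, sub_sub_cancel_left, neg_dotProduct,
      single_dotProduct]
    linear_combination (4 * Δ ^ 2 * halfDiff (p ⟨h, _⟩).2.1 (p ⟨h, _⟩).2.2 i ^ 2) *
      boolSign_mul_self (θ h i)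
  · rw [flipSign, Function.update_of_ne fun hth => ht (Subtype.ext hth), sub_self,
      zero_dotProduct, mul_zero, sq, mul_zero]

theorem sum_exp_sq_halfDiff_signDesign (i : Fin k) (c : ℝ) :
    ∑ j, Real.exp (c * halfDiff (signDesign k j).1 (signDesign k j).2 i ^ 2) =
      2 * (k + (Real.exp c - 1)) := by
  have hterm : ∀ j : Fin k × Bool,
      Real.exp (c * halfDiff (signDesign k j).1 (signDesign k j).2 i ^ 2) =
        1 + if i = j.1 then Real.exp c - 1 else 0 := fun j => by
    rw [halfDiff_signDesign, Pi.single_apply]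
    split_ifs <;> simp [sq]
  simp only [hterm]
  rw [Fintype.sum_prod_type_right]
  simp only [Finset.sum_add_distrib, Finset.sum_const, Finset.sum_ite_eq, Finset.mem_univ,
    if_true, Finset.card_univ, Fintype.card_bool, Fintype.card_fin, nsmul_eq_mul, mul_one]
  push_cast
  ring

theorem integral_likelihoodRatio_flipSign_sq [NeZero k] (ξ : stdSimplex ℝ Unit) (h : Fin H)
    (i : Fin k) (θ : Fin H → SignVector k) :
    ∫ z, likelihoodRatio (signGame hΔ hΔk θ) (signGame hΔ hΔk (flipSign h i θ)) z ^ 2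
      ∂(trajectoryLaw (signGame hΔ hΔk θ) ξ fun _ _ => uniformDesign (signDesign k)) =
      1 + (Real.exp (4 * Δ ^ 2) - 1) / k := by
  let f : SignVector k × SignVector k → ℝ := fun ab =>
    Real.exp (4 * Δ ^ 2 * halfDiff ab.1 ab.2 i ^ 2)
  have hk : (k : ℝ) ≠ 0 := NeZero.ne _
  rw [integral_trajectoryLaw _ _ _ ((measurable_likelihoodRatio _ _).pow_const 2)
    fun p => integrable_likelihoodRatio_sq_rewardLaw _ _ p]
  simp only [integral_likelihoodRatio_sq_rewardLaw, pathReward_signGame_flipSign_sub_sq,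
    Finset.sum_ite_eq', Finset.mem_univ, if_true]
  calc _ = ∑ ab, (uniformDesign (signDesign k)).1 ab * f ab :=
        sum_pathProb_mul_apply (signGame hΔ hΔk θ) (simplex_default ξ)
          (σ := fun _ _ => (uniformDesign (signDesign k)).1)
          (fun _ => (uniformDesign (signDesign k)).2.2) ⟨h, Nat.zero_le _⟩ fun x => f x.2
    _ = (Fintype.card (Fin k × Bool) : ℝ)⁻¹ * ∑ j, f (signDesign k j) :=
        sum_uniformDesign_smul (signDesign k) f
    _ = 1 + (Real.exp (4 * Δ ^ 2) - 1) / k := by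
        rw [sum_exp_sq_halfDiff_signDesign, Fintype.card_prod, Fintype.card_fin,
          Fintype.card_bool]
        push_cast
        field_simp

end FlipSign

section LowerBound

variable {k H K : ℕ}

/-- The sum of the mean signs of both players at step `h` and coordinate `i`. -/
noncomputable def totalMeanSign (h : Fin H) (i : Fin k)
    (σ : Policy Unit (SignVector k) H × Policy Unit (SignVector k) H) : ℝ :=
  meanSign (σ.1 h ()) i + meanSign (σ.2 h ()) i

theorem abs_totalMeanSign_le (h : Fin H) (i : Fin k)
    (σ : Policy Unit (SignVector k) H × Policy Unit (SignVector k) H) :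
    |totalMeanSign h i σ| ≤ 2 :=
  calc |totalMeanSign h i σ| ≤ |meanSign (σ.1 h ()) i| + |meanSign (σ.2 h ()) i| := abs_add_le _ _
    _ ≤ 1 + 1 := add_le_add (abs_meanSign_le _ i) (abs_meanSign_le _ i)
    _ = 2 := one_add_one_eq_two

theorem measurable_totalMeanSign (h : Fin H) (i : Fin k) :
    Measurable (totalMeanSign (k := k) (H := H) h i) :=
  ((measurable_meanSign_apply i).comp (by fun_prop)).add
    ((measurable_meanSign_apply i).comp (by fun_prop))

variable {Δ : ℝ} (hΔ : 0 ≤ Δ) (hΔk : Δ * k ≤ 1 / 2) (ξ : stdSimplex ℝ Unit)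
  {alg : Dataset Unit (SignVector k) (SignVector k) H K →
    Policy Unit (SignVector k) H × Policy Unit (SignVector k) H}

theorem expectedGap_signGame (halg : Measurable alg)
    (β : Fin H → Unit → stdSimplex ℝ (SignVector k × SignVector k)) (θ : Fin H → SignVector k) :
    expectedGap (signGame hΔ hΔk θ) ξ β alg = ∑ t : Step H 0, Δ / 2 * (2 * k - ∑ i,
      boolSign (θ t.1 i) * ∫ D, totalMeanSign t.1 i (alg D)
        ∂(datasetLaw (signGame hΔ hΔk θ) ξ β K)) := by
  set μ := datasetLaw (signGame hΔ hΔk θ) ξ β K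
  have hgap : ∀ D, ∑ x, ξ.1 x * dualityGap (signGame hΔ hΔk θ) (alg D).1 (alg D).2 x =
      ∑ t : Step H 0, Δ / 2 *
        (2 * k - ∑ i, boolSign (θ t.1 i) * totalMeanSign t.1 i (alg D)) := fun D => by
    rw [Fintype.sum_unique, simplex_default ξ, one_mul, dualityGap_signGame]
    rfl
  have hint : ∀ t i, Integrable (fun D => boolSign (θ t i) * totalMeanSign t i (alg D)) μ :=
    fun t i => (Integrable.of_bound
      ((measurable_totalMeanSign t i).comp halg).aestronglyMeasurable 2
      (ae_of_all _ fun D => abs_totalMeanSign_le t i (alg D))).const_mul _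
  have hint_sum : ∀ t, Integrable
      (fun D => ∑ i, boolSign (θ t i) * totalMeanSign t i (alg D)) μ :=
    fun t => integrable_finsetSum _ fun i _ => hint t i
  simp only [expectedGap, hgap]
  rw [integral_finsetSum _ fun t _ => ((integrable_const _).sub (hint_sum t.1)).const_mul _]
  refine Finset.sum_congr rfl fun t _ => ?_
  rw [integral_const_mul, integral_sub (integrable_const _) (hint_sum t.1), integral_const,
    probReal_univ, one_smul, integral_finsetSum _ fun i _ => hint t.1 i]
  simp only [integral_const_mul]

variable [NeZero k]

theorem sum_boolSign_mul_integral_totalMeanSign_le (halg : Measurable alg) (h : Fin H)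
    (i : Fin k) :
    ∑ θ : Fin H → SignVector k, boolSign (θ h i) * ∫ D, totalMeanSign h i (alg D)
        ∂(datasetLaw (signGame hΔ hΔk θ) ξ (fun _ _ => uniformDesign (signDesign k)) K) ≤
      Fintype.card (Fin H → SignVector k) *
        √((1 + (Real.exp (4 * Δ ^ 2) - 1) / k) ^ K - 1) := by
  let F : (Fin H → SignVector k) → ℝ := fun θ => ∫ D, totalMeanSign h i (alg D)
    ∂(datasetLaw (signGame hΔ hΔk θ) ξ (fun _ _ => uniformDesign (signDesign k)) K)
  have hclose : ∀ θ, |F (flipSign h i θ) - F θ| ≤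
      2 * √((1 + (Real.exp (4 * Δ ^ 2) - 1) / k) ^ K - 1) := fun θ => by
    rw [← integral_likelihoodRatio_flipSign_sq hΔ hΔk ξ h i θ]
    exact abs_integral_datasetLaw_sub_le (G := signGame hΔ hΔk θ)
      (G' := signGame hΔ hΔk (flipSign h i θ)) ξ _ rfl ((measurable_totalMeanSign h i).comp halg)
      fun D => abs_totalMeanSign_le h i (alg D)
  have haverage := sum_mul_le_of_involutive (flipSign_involutive h i)
    (s := fun θ => boolSign (θ h i)) (fun θ => (abs_boolSign _).le)
    (fun θ => by rw [flipSign_self_apply, boolSign_not]) hclose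
  rwa [mul_div_cancel_left₀ _ two_ne_zero] at haverage

theorem le_sum_expectedGap_signGame (halg : Measurable alg) :
    Fintype.card (Fin H → SignVector k) *
        (Δ * H * k * (1 - √((1 + (Real.exp (4 * Δ ^ 2) - 1) / k) ^ K - 1) / 2)) ≤
      ∑ θ, expectedGap (signGame hΔ hΔk θ) ξ (fun _ _ => uniformDesign (signDesign k)) alg := by
  set N : ℝ := (Fintype.card (Fin H → SignVector k) : ℝ)
  set ε := √((1 + (Real.exp (4 * Δ ^ 2) - 1) / k) ^ K - 1)
  calc N * (Δ * H * k * (1 - ε / 2))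
      = ∑ _t : Step H 0, Δ / 2 * (N * (2 * k) - ∑ _i : Fin k, N * ε) := by
        rw [Finset.sum_const, Finset.sum_const, Finset.card_univ, Finset.card_univ,
          card_step_zero, Fintype.card_fin, nsmul_eq_mul, nsmul_eq_mul]
        ring
    _ ≤ ∑ t : Step H 0, Δ / 2 * (N * (2 * k) - ∑ i : Fin k, ∑ θ : Fin H → SignVector k,
          boolSign (θ t.1 i) * ∫ D, totalMeanSign t.1 i (alg D) ∂(datasetLaw
            (signGame hΔ hΔk θ) ξ (fun _ _ => uniformDesign (signDesign k)) K)) := by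
        gcongr
        exact sum_boolSign_mul_integral_totalMeanSign_le hΔ hΔk ξ halg _ _
    _ = ∑ θ, expectedGap (signGame hΔ hΔk θ) ξ
          (fun _ _ => uniformDesign (signDesign k)) alg := by
        simp only [expectedGap_signGame hΔ hΔk ξ halg]
        rw [Finset.sum_comm]
        refine Finset.sum_congr rfl fun t _ => ?_
        rw [← Finset.mul_sum, Finset.sum_sub_distrib, Finset.sum_const, Finset.card_univ,
          nsmul_eq_mul, Finset.sum_comm]

theorem le_iSup_expectedGap_signGame (halg : Measurable alg) :
    Δ * H * k * (1 - √((1 + (Real.exp (4 * Δ ^ 2) - 1) / k) ^ K - 1) / 2) ≤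
      ⨆ M : Set.range (signGame (H := H) hΔ hΔk),
        expectedGap M.1 ξ (fun _ _ => uniformDesign (signDesign k)) alg := by
  have hbdd : BddAbove (Set.range fun M : Set.range (signGame (H := H) hΔ hΔk) =>
      expectedGap M.1 ξ (fun _ _ => uniformDesign (signDesign k)) alg) :=
    (Set.finite_range _).bddAbove
  have hcard : (0 : ℝ) < Fintype.card (Fin H → SignVector k) := Nat.cast_pos.2 Fintype.card_pos
  refine le_of_mul_le_mul_left ((le_sum_expectedGap_signGame hΔ hΔk ξ halg).trans ?_) hcard
  rw [← nsmul_eq_mul, ← Finset.card_univ]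
  exact Finset.sum_le_card_nsmul _ _ _ fun θ _ => le_ciSup hbdd ⟨_, θ, rfl⟩

end LowerBound

section RewardGap

variable {k K : ℕ}

/-- The reward gap `Δ = √(k / K) / 8` at which neighbouring sign games cannot be told apart from
`K` trajectories. -/
noncomputable def rewardGap (k K : ℕ) : ℝ := √(k / K) / 8

theorem rewardGap_nonneg (k K : ℕ) : 0 ≤ rewardGap k K := by
  rw [rewardGap]
  positivity

theorem rewardGap_sq (k K : ℕ) : rewardGap k K ^ 2 = k / K / 64 := by
  rw [rewardGap, div_pow, Real.sq_sqrt (by positivity)]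
  norm_num

theorem rewardGap_mul_le (hK : (k : ℝ) ^ 3 ≤ 16 * K) : rewardGap k K * k ≤ 1 / 2 := by
  refine (abs_le_of_sq_le_sq' ?_ one_half_pos.le).2
  calc (rewardGap k K * k) ^ 2 = k ^ 3 / K / 64 := by
        rw [mul_pow, rewardGap_sq]
        ring
    _ ≤ 16 / 64 := by
        gcongr
        exact div_le_of_le_mul₀ K.cast_nonneg (by norm_num) hK
    _ = (1 / 2) ^ 2 := by norm_num

theorem one_add_div_pow_le_exp {x : ℝ} (hx : 0 ≤ x) (K : ℕ) :
    (1 + x / K) ^ K ≤ Real.exp x := by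
  rcases K.eq_zero_or_pos with rfl | hK
  · simpa using hx
  calc (1 + x / K) ^ K ≤ Real.exp (x / K) ^ K := by
        gcongr
        rw [add_comm]
        exact Real.add_one_le_exp _
    _ = Real.exp x := by
        rw [← Real.exp_nat_mul, mul_div_cancel₀ _ (by positivity)]

theorem exp_sub_one_le_two_mul {x : ℝ} (hx₀ : 0 ≤ x) (hx₁ : x ≤ 1) : Real.exp x - 1 ≤ 2 * x := by
  have h := (le_abs_self _).trans (Real.abs_exp_sub_one_le (x := x) (by rwa [abs_of_nonneg hx₀]))
  rwa [abs_of_nonneg hx₀] at h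

theorem sqrt_one_add_exp_rewardGap_pow_sub_one_le [NeZero k] (hkK : k ≤ 16 * K) :
    √((1 + (Real.exp (4 * rewardGap k K ^ 2) - 1) / k) ^ K - 1) ≤ 1 / 2 := by
  have hk : (k : ℝ) ≠ 0 := NeZero.ne _
  have hgap : 4 * rewardGap k K ^ 2 = k / K / 16 := by
    rw [rewardGap_sq]
    ring
  have hgap_le : 4 * rewardGap k K ^ 2 ≤ 1 := by
    rw [hgap, div_div, mul_comm]
    exact div_le_one_of_le₀ (mod_cast hkK) (by positivity)
  have hrate : (Real.exp (4 * rewardGap k K ^ 2) - 1) / k ≤ 1 / 8 / K :=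
    calc (Real.exp (4 * rewardGap k K ^ 2) - 1) / k ≤ 2 * (4 * rewardGap k K ^ 2) / k := by
          gcongr
          exact exp_sub_one_le_two_mul (by positivity) hgap_le
      _ = 1 / 8 / K := by
          rw [hgap]
          field_simp
          norm_num
  have hnonneg : 0 ≤ (Real.exp (4 * rewardGap k K ^ 2) - 1) / k :=
    div_nonneg (sub_nonneg.2 (Real.one_le_exp (by positivity))) k.cast_nonneg
  rw [Real.sqrt_le_left one_half_pos.le, sub_le_iff_le_add]
  calc (1 + (Real.exp (4 * rewardGap k K ^ 2) - 1) / k) ^ K ≤ (1 + 1 / 8 / K) ^ K := by gcongr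
    _ ≤ Real.exp (1 / 8) := one_add_div_pow_le_exp (by norm_num) K
    _ ≤ (1 / 2) ^ 2 + 1 := by
        linarith [exp_sub_one_le_two_mul (x := 1 / 8) (by norm_num) (by norm_num)]

theorem three_quarters_mul_rewardGap_le_iSup_expectedGap [NeZero k] {H : ℕ}
    (hΔk : rewardGap k K * k ≤ 1 / 2) (hkK : k ≤ 16 * K) (ξ : stdSimplex ℝ Unit)
    {alg : Dataset Unit (SignVector k) (SignVector k) H K →
      Policy Unit (SignVector k) H × Policy Unit (SignVector k) H} (halg : Measurable alg) :
    3 / 4 * rewardGap k K * H * k ≤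
      ⨆ M : Set.range (signGame (H := H) (rewardGap_nonneg k K) hΔk),
        expectedGap M.1 ξ (fun _ _ => uniformDesign (signDesign k)) alg :=
  calc 3 / 4 * rewardGap k K * H * k = rewardGap k K * H * k * (1 - 1 / 2 / 2) := by ring
    _ ≤ _ := by
        gcongr ?_ * (1 - ?_ / 2)
        · exact mul_nonneg (mul_nonneg (rewardGap_nonneg k K) H.cast_nonneg) k.cast_nonneg
        · exact sqrt_one_add_exp_rewardGap_pow_sub_one_le hkK
    _ ≤ _ := le_iSup_expectedGap_signGame _ hΔk ξ halg

theorem sqrt_div_card_signDesign_eq [NeZero k] :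
    √(k / (K * (Fintype.card (Fin k × Bool) : ℝ)⁻¹ / 2)) = 16 * (√k * rewardGap k K) := by
  have : (k : ℝ) ≠ 0 := NeZero.ne _
  calc √(k / (K * (Fintype.card (Fin k × Bool) : ℝ)⁻¹ / 2)) = √(2 ^ 2 * (k * (k / K))) := by
        rw [Fintype.card_prod, Fintype.card_fin, Fintype.card_bool]
        push_cast
        field_simp
    _ = 16 * (√k * rewardGap k K) := by
        rw [Real.sqrt_mul (by positivity), Real.sqrt_sq zero_le_two,
          Real.sqrt_mul k.cast_nonneg, rewardGap]
        ring

theorem sqrt_succ_le_three_halves_mul_sqrt [NeZero k] : √((k + 1 : ℕ) : ℝ) ≤ 3 / 2 * √k := by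
  have hk : (1 : ℝ) ≤ k := Nat.one_le_cast.2 NeZero.one_le
  rw [Real.sqrt_le_left (by positivity), mul_pow, Real.sq_sqrt k.cast_nonneg]
  push_cast
  linarith

theorem sqrt_succ_mul_complexity_signFeature_le [NeZero k] [NeZero K] {H : ℕ} {reg : ℝ}
    (hreg : 0 < reg) (G : MarkovGame Unit (SignVector k) (SignVector k) H)
    (ξ : stdSimplex ℝ Unit) (π ν : Policy Unit (SignVector k) H)
    {D : Dataset Unit (SignVector k) (SignVector k) H K}
    (hD : ∀ h j, K * (Fintype.card (Fin k × Bool) : ℝ)⁻¹ / 2 ≤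
      actionCount D h (signDesign k j)) :
    1 / 64 * √((k + 1 : ℕ) : ℝ) * complexity G (signFeature k) reg ξ π ν D ≤
      3 / 4 * rewardGap k K * H * k := by
  have hcount : 0 < K * (Fintype.card (Fin k × Bool) : ℝ)⁻¹ / 2 := by
    have : (0 : ℝ) < K := Nat.cast_pos.2 (NeZero.pos K)
    have : (0 : ℝ) < Fintype.card (Fin k × Bool) := Nat.cast_pos.2 Fintype.card_pos
    positivity
  have hcomplexity : complexity G (signFeature k) reg ξ π ν D ≤
      2 * (H * (16 * (√k * rewardGap k K))) := by
    rw [← sqrt_div_card_signDesign_eq]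
    exact complexity_le G (signDesign k) hreg ξ π ν D hcount hD fun a b =>
      ⟨signDesignCoeff a b, (sum_signDesignCoeff_smul a b).symm, sum_signDesignCoeff_sq_le a b⟩
  have hgap := rewardGap_nonneg k K
  calc 1 / 64 * √((k + 1 : ℕ) : ℝ) * complexity G (signFeature k) reg ξ π ν D
      ≤ 1 / 64 * √((k + 1 : ℕ) : ℝ) * (2 * (H * (16 * (√k * rewardGap k K)))) := by gcongr
    _ ≤ 1 / 64 * (3 / 2 * √k) * (2 * (H * (16 * (√k * rewardGap k K)))) := by
        gcongr
        exact sqrt_succ_le_three_halves_mul_sqrt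
    _ = 3 / 4 * rewardGap k K * H * k := by
        linear_combination 3 / 4 * rewardGap k K * H * Real.mul_self_sqrt k.cast_nonneg

end RewardGap

theorem mul_pow_three_le_and_mul_mul_log_le {H d : ℕ} {C δ x : ℝ} (hC : 0 ≤ C) (hH : 1 ≤ H)
    (hd : 2 ≤ d) (hδ : 0 < δ) (hδ₁ : δ < 1)
    (h : C * (d : ℝ) ^ 4 * Real.log (2 * H * d / δ) ≤ x) :
    C * (d : ℝ) ^ 3 ≤ x ∧ C * d * Real.log (2 * H * d / δ) ≤ x := by
  have hd' : (2 : ℝ) ≤ d := Nat.ofNat_le_cast.2 hd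
  have hH' : (1 : ℝ) ≤ H := Nat.one_le_cast.2 hH
  have hlog : 1 / 2 ≤ Real.log (2 * H * d / δ) := by
    have harg : 2 ≤ 2 * H * d / δ := by
      rw [le_div_iff₀ hδ]
      nlinarith
    linarith [Real.log_two_gt_d9, Real.log_le_log two_pos harg]
  constructor
  · calc C * (d : ℝ) ^ 3 = C * d ^ 3 * (2 * (1 / 2)) := by ring
      _ ≤ C * d ^ 3 * (d * Real.log (2 * H * d / δ)) := by gcongr
      _ = C * d ^ 4 * Real.log (2 * H * d / δ) := by ring
      _ ≤ x := h
  · calc C * d * Real.log (2 * H * d / δ) ≤ C * d ^ 4 * Real.log (2 * H * d / δ) := by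
          gcongr
          exact le_self_pow₀ (by linarith) four_ne_zero
      _ ≤ x := h

end OfflineMG

open OfflineMG in
theorem theorem5_general :
    ∃ c C : ℝ, 0 < c ∧ 0 < C ∧
      ∀ (H d K : ℕ) (δ : ℝ), 2 ≤ d → 0 < δ → C * (d : ℝ) ^ 3 ≤ K →
        C * d * Real.log (2 * H * d / δ) ≤ K →
        ∃ (S A B : Type) (_ : Fintype S) (_ : DecidableEq S) (_ : Fintype A) (_ : Fintype B)
          (φ : S → A → B → EuclideanSpace ℝ (Fin d))
          (ξ : stdSimplex ℝ S) (β : Fin H → S → stdSimplex ℝ (A × B))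
          (𝓜 : Set (MarkovGame S A B H)),
          𝓜.Nonempty ∧
          (∀ G ∈ 𝓜, IsLinear G φ ∧
            (∀ h, (featureCov G φ ξ β h).PosDef) ∧
            ∃ πs νs, IsNash G πs νs) ∧
          ∀ alg : Dataset S A B H K →
              Policy S A H × Policy S B H, Measurable alg →
            ∀ reg : ℝ, 0 < reg →
              ∀ G ∈ 𝓜, ∀ πs νs,
                1 - δ ≤ (datasetLaw G ξ β K).real
                  {D | c * √(d : ℝ) * complexity G φ reg ξ πs νs D ≤
                    ⨆ M : 𝓜, expectedGap M.1 ξ β alg} := by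
  refine ⟨1 / 64, 20, by norm_num, by norm_num, fun H d K δ hd hδ hcube hlog => ?_⟩
  obtain ⟨k, rfl⟩ : ∃ k, d = k + 1 := ⟨d - 1, by omega⟩
  have : NeZero k := ⟨by omega⟩
  have hK : (0 : ℝ) < K := hcube.trans_lt' (by positivity)
  have : NeZero K := ⟨(Nat.cast_pos.1 hK).ne'⟩
  have hk : (k : ℝ) ≤ (k + 1 : ℕ) := by norm_num
  have hkK : (k : ℝ) ^ 3 ≤ 16 * K := by linarith [pow_le_pow_left₀ k.cast_nonneg hk 3]
  have hΔk := rewardGap_mul_le hkK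
  refine ⟨Unit, SignVector k, SignVector k, inferInstance, inferInstance, inferInstance,
    inferInstance, signFeature k, stdSimplex.barycenter, fun _ _ => uniformDesign (signDesign k),
    Set.range (signGame (rewardGap_nonneg k K) hΔk), Set.range_nonempty _, ?_,
    fun alg halg reg hreg G _ πs νs => ?_⟩
  · rintro _ ⟨θ, rfl⟩
    exact ⟨isLinear_signGame _ hΔk θ, posDef_featureCov_uniformDesign _ _ _ fun w =>
      eq_zero_of_signFeature_signDesign_dotProduct_eq_zero, _, _, isNash_signGame _ hΔk θ⟩
  · refine (one_sub_le_measureReal_actionCount_of_log_le G _ (signDesign k)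
      (m := 2 * (k + 1 : ℕ)) ?_ hδ ?_).trans (measureReal_mono fun D hD => ?_)
    · rw [Fintype.card_prod, Fintype.card_fin, Fintype.card_bool]
      push_cast
      linarith
    · convert hlog using 1
      ring_nf
    · exact (sqrt_succ_mul_complexity_signFeature_le hreg G _ πs νs hD).trans
        (three_quarters_mul_rewardGap_le_iSup_expectedGap hΔk
          ((Nat.le_self_pow three_ne_zero k).trans (mod_cast hkK)) _ halg)

theorem theorem5 :
    ∃ c C : ℝ, 0 < c ∧ 0 < C ∧
      ∀ (H d K : ℕ) (δ : ℝ), 1 ≤ H → 2 ≤ d → 0 < δ → δ < 1 →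
        C * (d : ℝ) ^ 4 * Real.log (2 * H * d / δ) ≤ K →
        ∃ (S A B : Type) (_ : Fintype S) (_ : DecidableEq S) (_ : Fintype A) (_ : Fintype B)
          (φ : S → A → B → EuclideanSpace ℝ (Fin d))
          (ξ : stdSimplex ℝ S) (β : Fin H → S → stdSimplex ℝ (A × B))
          (𝓜 : Set (OfflineMG.MarkovGame S A B H)),
          𝓜.Nonempty ∧
          (∀ G ∈ 𝓜, OfflineMG.IsLinear G φ ∧
            (∀ h, (OfflineMG.featureCov G φ ξ β h).PosDef) ∧
            ∃ πs νs, OfflineMG.IsNash G πs νs) ∧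
          ∀ alg : OfflineMG.Dataset S A B H K →
              OfflineMG.Policy S A H × OfflineMG.Policy S B H, Measurable alg →
            ∀ reg : ℝ, 0 < reg →
              ∀ G ∈ 𝓜, ∀ πs νs, OfflineMG.IsNash G πs νs →
                1 - δ ≤ (OfflineMG.datasetLaw G ξ β K).real
                  {D | c * √(d : ℝ) * OfflineMG.complexity G φ reg ξ πs νs D ≤
                    ⨆ M : 𝓜, OfflineMG.expectedGap M.1 ξ β alg} := by
  obtain ⟨c, C, hc, hC, hbound⟩ := theorem5_general
  refine ⟨c, C, hc, hC, fun H d K δ hH hd hδ hδ₁ hK => ?_⟩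
  obtain ⟨hcube, hlog⟩ :=
    OfflineMG.mul_pow_three_le_and_mul_mul_log_le hC.le hH hd hδ hδ₁ hK
  obtain ⟨S, A, B, iS, iS', iA, iB, φ, ξ, β, 𝓜, hne, h𝓜, hlower⟩ :=
    hbound H d K δ hd hδ hcube hlog
  exact ⟨S, A, B, iS, iS', iA, iB, φ, ξ, β, 𝓜, hne, h𝓜,
    fun alg halg reg hreg G hG πs νs _ => hlower alg halg reg hreg G hG πs νs⟩
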